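/- Let $\Lambda=\Lambda_{\mathbb Q}=\mathbb Q[p_1,p_2,\dots]$ be the ring of symmetric functions over $\mathbb Q$ in countably many variables $x_1,x_2,\dots$, where $p_n=\sum_i x_i^n$ is the $n$-th power sum, and let $\Lambda_{\mathbb Z}\subset\Lambda$ be the lattice of symmetric functions with integer coefficients. Define the vertex operators $\Lambda\to\Lambda[[z,z^{-1}]]$ $$Y(z)=\exp\Big(\sum_{n\ge1}\frac{p_n}{n}z^n\Big)\exp\Big(-\sum_{n\ge1}\frac{\partial}{\partial p_n}(z^{-n}+z^n)\Big)=\sum_{n\in\mathbb Z}Y_nz^{-n},$$ $$W^*(z)=\exp\Big(-\sum_{n\ge1}\frac{p_n}{n}z^n\Big)\exp\Big(\sum_{n\ge1}\frac{\partial}{\partial p_n}(z^{-n}+z^n)\Big)=\sum_{n\in\mathbb Z}W^*_nz^{n},$$ $$Y^*(z)=(1-z^2)W^*(z)=\sum_{n\in\mathbb Z}Y^*_nz^{n},\qquad W(z)=(1-z^2)Y(z)=\sum_{n\in\mathbb Z}W_nz^{-n}.$$ Then for every partition $\lambda=(\lambda_1\ge\dots\ge\lambda_l>0)$ with conjugate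 partition $\lambda'=(\lambda'_1\ge\dots\ge\lambda'_k>0)$ one has $$Y_{-\lambda_1}\cdots Y_{-\lambda_l}.1=(-1)^{|\lambda|}\,Y^*_{\lambda'_1}\cdots Y^*_{\lambda'_k}.1,\qquad W_{-\lambda_1}\cdots W_{-\lambda_l}.1=(-1)^{|\lambda|}\,W^*_{\lambda'_1}\cdots W^*_{\lambda'_k}.1 .$$ Moreover each of the four families $\{Y_{-\lambda_1}\cdots Y_{-\lambda_l}.1\}$, $\{Y^*_{\lambda'_1}\cdots Y^*_{\lambda'_k}.1\}$, $\{W_{-\lambda_1}\cdots W_{-\lambda_l}.1\}$, $\{W^*_{\lambda'_1}\cdots W^*_{\lambda'_k}.1\}$, indexed by all partitions $\lambda$, is a $\mathbb Z$-basis of $\Lambda_{\mathbb Z}$. -/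

import Mathlib

open MvPolynomial

noncomputable section

/-- The Fock space `Λ = ℚ[p₁, p₂, …]`: the ring of symmetric functions over `ℚ` written in the
power sums; the variable `X n` is `p_n`. -/
abbrev Fock : Type := MvPolynomial ℕ+ ℚ

/-- Formal distributions `Λ[[z, z⁻¹]]`; `F m` is the coefficient of `z ^ m`. -/
abbrev FormalDist : Type := ℤ → Fock

/-- The series `∑_{n ≥ 1} ε (p_n / n) z ^ n`. -/
def creationSeries (ε : ℚ) : PowerSeries Fock :=
  PowerSeries.mk fun n => if h : 0 < n then C (ε / (n : ℚ)) * X ⟨n, h⟩ else 0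

/-- The series `exp (∑_{n ≥ 1} ε (p_n / n) z ^ n)`. -/
def expCreation (ε : ℚ) : PowerSeries Fock :=
  (PowerSeries.exp ℚ).subst (creationSeries ε)

/-- The operator `∑_{n ≥ 1} ∂/∂p_n (z ^ (-n) + z ^ n)`, acting coefficientwise. It is used only on
Laurent polynomials in `z`, where the sum is finite. -/
def annihilation (F : FormalDist) : FormalDist :=
  fun m => ∑ᶠ n : ℕ+, pderiv n (F (m + (n : ℤ)) + F (m - (n : ℤ)))

/-- `exp (-ε ∑_{n ≥ 1} ∂/∂p_n (z ^ (-n) + z ^ n)) f` for `f ∈ Λ`. The `k`-th iterate of the operator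
vanishes on `f` as soon as `k` exceeds the degree of the polynomial `f`, so the sum is finite, and
the result is a Laurent polynomial in `z`. -/
def expAnnihilation (ε : ℚ) (f : Fock) : FormalDist :=
  fun m => ∑ᶠ k : ℕ, ((-ε) ^ k / (k.factorial : ℚ)) • (annihilation^[k] (Pi.single 0 f)) m

/-- The product of a power series in `z` with a formal distribution (used for Laurent polynomials,
where each coefficient is a finite sum). -/
def powerSeriesMul (H : PowerSeries Fock) (F : FormalDist) : FormalDist :=
  fun m => ∑ᶠ i : ℕ, PowerSeries.coeff i H * F (m - (i : ℤ))

/-- Multiplication of a formal distribution by `1 - z ^ 2`. -/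
def oneSubSqMul (F : FormalDist) : FormalDist :=
  fun m => F m - F (m - 2)

/-- `exp (ε ∑ p_n / n z ^ n) exp (-ε ∑ ∂/∂p_n (z ^ (-n) + z ^ n)) f`. -/
def vertexOperator (ε : ℚ) (f : Fock) : FormalDist :=
  powerSeriesMul (expCreation ε) (expAnnihilation ε f)

/-- The vertex operator `Y(z)`. -/
def symplecticY (f : Fock) : FormalDist := vertexOperator 1 f

/-- The vertex operator `W*(z)`. -/
def orthogonalWStar (f : Fock) : FormalDist := vertexOperator (-1) f

/-- The vertex operator `Y*(z) = (1 - z ^ 2) W*(z)`. -/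
def symplecticYStar (f : Fock) : FormalDist := oneSubSqMul (orthogonalWStar f)

/-- The vertex operator `W(z) = (1 - z ^ 2) Y(z)`. -/
def orthogonalW (f : Fock) : FormalDist := oneSubSqMul (symplecticY f)

/-- `Y_n`, where `Y(z) = ∑ Y_n z ^ (-n)`. -/
def modeY (n : ℤ) (f : Fock) : Fock := symplecticY f (-n)

/-- `W_n`, where `W(z) = ∑ W_n z ^ (-n)`. -/
def modeW (n : ℤ) (f : Fock) : Fock := orthogonalW f (-n)

/-- `Y*_n`, where `Y*(z) = ∑ Y*_n z ^ n`. -/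
def modeYStar (n : ℤ) (f : Fock) : Fock := symplecticYStar f n

/-- `W*_n`, where `W*(z) = ∑ W*_n z ^ n`. -/
def modeWStar (n : ℤ) (f : Fock) : Fock := orthogonalWStar f n

/-- `Y_{-λ₁} ⋯ Y_{-λ_l} . 1`, where `λ₁ ≥ ⋯ ≥ λ_l > 0` are the parts of `lam`. -/
def vectorY (lam : YoungDiagram) : Fock :=
  lam.rowLens.foldr (fun r v => modeY (-(r : ℤ)) v) 1

/-- `W_{-λ₁} ⋯ W_{-λ_l} . 1`. -/
def vectorW (lam : YoungDiagram) : Fock :=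
  lam.rowLens.foldr (fun r v => modeW (-(r : ℤ)) v) 1

/-- `Y*_{λ₁} ⋯ Y*_{λ_l} . 1`. -/
def vectorYStar (lam : YoungDiagram) : Fock :=
  lam.rowLens.foldr (fun r v => modeYStar (r : ℤ) v) 1

/-- `W*_{λ₁} ⋯ W*_{λ_l} . 1`. -/
def vectorWStar (lam : YoungDiagram) : Fock :=
  lam.rowLens.foldr (fun r v => modeWStar (r : ℤ) v) 1

/-- The power sum `p_n = ∑ᵢ xᵢ ^ n` as a formal power series in countably many variables. -/
def powerSum (n : ℕ+) : MvPowerSeries ℕ ℚ :=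
  open Classical in fun m => if ∃ i : ℕ, m = Finsupp.single i (n : ℕ) then 1 else 0

/-- The realization of `ℚ[p₁, p₂, …]` by symmetric functions in the variables `x₀, x₁, …`. -/
def realize : Fock →ₐ[ℚ] MvPowerSeries ℕ ℚ := aeval powerSum

/-- The lattice `Λ_ℤ` of symmetric functions with integer coefficients: the formal power series of
bounded degree in countably many variables that are invariant under all permutations of the
variables and have integer coefficients. -/
def integralSymmetricFunctions : Submodule ℤ (MvPowerSeries ℕ ℚ) where
  carrier := {f |
    (∀ (σ : Equiv.Perm ℕ) (m : ℕ →₀ ℕ),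
      MvPowerSeries.coeff (m.mapDomain σ) f = MvPowerSeries.coeff m f) ∧
    (∃ d : ℕ, ∀ m : ℕ →₀ ℕ, MvPowerSeries.coeff m f ≠ 0 → m.degree ≤ d) ∧
    (∀ m : ℕ →₀ ℕ, ∃ c : ℤ, MvPowerSeries.coeff m f = (c : ℚ))}
  zero_mem' := ⟨fun _ _ => by simp, ⟨0, fun _ h => by simp at h⟩, fun _ => ⟨0, by simp⟩⟩
  add_mem' := by
    rintro f g ⟨hf, ⟨d, hd⟩, hf'⟩ ⟨hg, ⟨e, he⟩, hg'⟩
    refine ⟨fun σ m => by simp [hf, hg], ⟨max d e, fun m hm => ?_⟩, fun m => ?_⟩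
    · by_cases h : MvPowerSeries.coeff m f = 0
      · exact (he m (by simpa [h] using hm)).trans (le_max_right _ _)
      · exact (hd m h).trans (le_max_left _ _)
    · obtain ⟨a, ha⟩ := hf' m
      obtain ⟨b, hb⟩ := hg' m
      exact ⟨a + b, by simp [ha, hb]⟩
  smul_mem' := by
    rintro c f ⟨hf, ⟨d, hd⟩, hf'⟩
    have key : ∀ m : ℕ →₀ ℕ,
        MvPowerSeries.coeff m (c • f) = (c : ℚ) * MvPowerSeries.coeff m f := fun m => by
      rw [map_zsmul, zsmul_eq_mul]
    refine ⟨fun σ m => by rw [key, key, hf], ⟨d, fun m hm => hd m fun h => hm ?_⟩, fun m => ?_⟩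
    · rw [key, h, mul_zero]
    · obtain ⟨a, ha⟩ := hf' m
      exact ⟨c * a, by rw [key, ha, Int.cast_mul]⟩

/-- A family of elements of `Λ = ℚ[p₁, p₂, …]`, regarded as symmetric functions in `x₀, x₁, …`, is a
`ℤ`-basis of the lattice of symmetric functions with integer coefficients. -/
def IsIntegralBasis {ι : Type} (v : ι → Fock) : Prop :=
  LinearIndependent ℤ (fun i => realize (v i)) ∧
    Submodule.span ℤ (Set.range fun i => realize (v i)) = integralSymmetricFunctions

end

open MvPolynomial

noncomputable section

/-! Write g_n for the coefficient of z^n in exp(ε ∑ p_n z^n / n): complete symmetric functions for ε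
= 1, signed elementary ones (-1)^n e_n for ε = -1. The annihilating exponential is a Taylor shift,
that is, the algebra homomorphism p_n ↦ p_n - ε(z^n + z^(-n)). It multiplies the generating series
in w of the g_n by (1 - zw)(1 - w/z), and divides that of the opposite sign by the same factor.

Conjugation. Let M(a,b) = Y_{-a} W*_b + W*_{b+1} Y_{-(a-1)}. Commuting p_n past M only shifts a or b
by ±n, so identities between the M(a,b) need checking only on the vacuum 1. There, the two
generating-series rules show that M depends on a + b alone, and ∑ h_i (-1)^j e_j = 0 shows that
M(a,b) = M(a,b-2) when a + b > 0. The factor 1 - z^2 cancels exactly this 2-periodicity, so Y with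
Y*, and W with W*, satisfy A_a B_b = -B_{b+1} A_{a-1} for a + b > 0. Moving A_a through a factors B
raises each index by one and ends with A_0.1 = 1. Combinatorially, adding a row of length a adds a
box to each of the first a columns; induction on the rows gives both identities
(`modeVector_eq_conjugate`).

Bases. For Y and W*, the mode of index a is multiplication by g_a, up to terms of lower weight or of
equal weight containing some g_k with k > a (`vertexMode_sub_mem`). This triangularity shows that
the vectors span the same lattice as the monomials in the g_n. Independence follows by a rank
argument in each bounded weight. The monomials in the g_n form a basis of Λ_ℤ by the fundamental
theorem of symmetric functions, deduced from its version in finitely many variables. The families Y*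
and W then differ from Y and W* only by signs and reindexing. -/

/-! ### Creation series and their logarithmic derivatives -/

open PowerSeries in
/-- A power series over a `ℚ`-algebra is determined by its constant coefficient and a first order
linear differential equation. -/
theorem PowerSeries.eq_of_derivative_eq_mul {K : Type*} [CommRing K] [Algebra ℚ K]
    {F G S : PowerSeries K} (hF : derivative K F = F * S) (hG : derivative K G = G * S)
    (h0 : coeff 0 F = coeff 0 G) : F = G := by
  ext n
  induction n using Nat.strong_induction_on with
  | _ n ih =>
    cases n with
    | zero => exact h0
    | succ n =>
      have h1 := congrArg (coeff n) hF
      have h2 := congrArg (coeff n) hG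
      rw [coeff_derivative, coeff_mul] at h1 h2
      have h3 : coeff (n + 1) F * ((n : K) + 1) = coeff (n + 1) G * ((n : K) + 1) := by
        rw [h1, h2]
        refine Finset.sum_congr rfl fun x hx => ?_
        rw [ih x.1 (by have := Finset.HasAntidiagonal.mem_antidiagonal.1 hx; omega)]
      have hu : IsUnit ((n : K) + 1) := by
        have : IsUnit (algebraMap ℚ K ((n : ℚ) + 1)) :=
          (IsUnit.mk0 _ (by positivity)).map _
        simpa using this
      exact hu.mul_left_injective h3

/-- The logarithmic derivative `∑ p_{n+1} zⁿ` of `expCreation 1`. -/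
def powerSumSeries : PowerSeries Fock := PowerSeries.mk fun n => X n.succPNat

theorem coeff_zero_creationSeries (ε : ℚ) : PowerSeries.constantCoeff (creationSeries ε) = 0 := by
  rw [← PowerSeries.coeff_zero_eq_constantCoeff_apply]
  simp [creationSeries]

theorem hasSubst_creationSeries (ε : ℚ) : PowerSeries.HasSubst (creationSeries ε) :=
  PowerSeries.HasSubst.of_constantCoeff_zero' (coeff_zero_creationSeries ε)

theorem derivative_creationSeries (ε : ℚ) :
    PowerSeries.derivative Fock (creationSeries ε) = PowerSeries.C (C ε) * powerSumSeries := by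
  ext1 n
  rw [PowerSeries.coeff_derivative, PowerSeries.coeff_C_mul]
  simp only [creationSeries, powerSumSeries, PowerSeries.coeff_mk, dif_pos (Nat.succ_pos n)]
  have h : ((n : Fock) + 1) = C ((n : ℚ) + 1) := by simp
  have h2 : ((n + 1 : ℕ) : ℚ) = (n : ℚ) + 1 := by push_cast; rfl
  have h3 : (n : ℚ) + 1 ≠ 0 := by positivity
  rw [h, h2, mul_right_comm, ← C_mul, div_mul_cancel₀ _ h3]
  rfl

theorem expCreation_eq (ε : ℚ) :
    expCreation ε = (PowerSeries.exp Fock).subst (creationSeries ε) := by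
  ext1 n
  rw [expCreation, PowerSeries.coeff_subst' (hasSubst_creationSeries ε),
    PowerSeries.coeff_subst' (hasSubst_creationSeries ε)]
  refine finsum_congr fun d => ?_
  rw [PowerSeries.coeff_exp, PowerSeries.coeff_exp, algebraMap_smul, algebraMap_smul]

theorem derivative_expCreation (ε : ℚ) :
    PowerSeries.derivative Fock (expCreation ε) =
      expCreation ε * (PowerSeries.C (C ε) * powerSumSeries) := by
  rw [expCreation_eq, PowerSeries.derivative_subst (hasSubst_creationSeries ε),
    PowerSeries.derivative_exp, derivative_creationSeries]

theorem coeff_zero_expCreation (ε : ℚ) : PowerSeries.coeff 0 (expCreation ε) = 1 := by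
  rw [expCreation_eq, PowerSeries.coeff_subst' (hasSubst_creationSeries ε),
    finsum_eq_single _ 0]
  · simp [PowerSeries.coeff_exp]
  · intro n hn
    simp [coeff_zero_creationSeries, hn]

/-- The opposite logarithmic derivatives cancel, so the product has derivative zero and constant
coefficient 1. -/
theorem expCreation_mul_expCreation_neg (ε : ℚ) : expCreation ε * expCreation (-ε) = 1 := by
  refine PowerSeries.eq_of_derivative_eq_mul (S := 0) ?_ ?_ ?_
  · rw [Derivation.leibniz, derivative_expCreation, derivative_expCreation]
    simp only [map_neg, smul_eq_mul]
    ring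
  · simp
  · rw [PowerSeries.coeff_mul]
    simp [coeff_zero_expCreation]

/-! ### The Taylor shift on generating series -/

/-- The substitution `p_n ↦ p_n - ε (z ^ n + z ^ (-n))`, which is
`exp (-ε ∑ ∂/∂p_n (z ^ (-n) + z ^ n))`. -/
def shiftHom (ε : ℚ) : Fock →ₐ[ℚ] LaurentPolynomial Fock :=
  aeval fun n : ℕ+ => LaurentPolynomial.C (X n) -
    ε • (LaurentPolynomial.T (n : ℤ) + LaurentPolynomial.T (-(n : ℤ)))

theorem derivative_one_sub_C_mul_X {K : Type*} [CommRing K] (c : K) :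
    PowerSeries.derivative K (1 - PowerSeries.C c * PowerSeries.X) =
      (1 - PowerSeries.C c * PowerSeries.X) * -PowerSeries.mk fun n => c ^ (n + 1) := by
  have h : (1 - PowerSeries.C c * PowerSeries.X) * (PowerSeries.mk fun n => c ^ (n + 1)) =
      PowerSeries.C c := by
    ext1 n
    rw [sub_mul, one_mul, mul_assoc, map_sub, PowerSeries.coeff_C_mul]
    cases n with
    | zero => simp
    | succ n =>
      rw [PowerSeries.coeff_succ_X_mul, PowerSeries.coeff_mk, PowerSeries.coeff_mk,
        PowerSeries.coeff_C, if_neg (Nat.succ_ne_zero n)]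
      ring
  rw [mul_neg, h, map_sub, Derivation.leibniz]
  simp

/-- `(1 - z w) (1 - z⁻¹ w)`. -/
def quadFactor : PowerSeries (LaurentPolynomial Fock) :=
  (1 - PowerSeries.C (LaurentPolynomial.T 1) * PowerSeries.X) *
    (1 - PowerSeries.C (LaurentPolynomial.T (-1)) * PowerSeries.X)

/-- `∑ (z ^ (n + 1) + z ^ (- n - 1)) w ^ n`. -/
def shiftSeries : PowerSeries (LaurentPolynomial Fock) :=
  PowerSeries.mk fun n => LaurentPolynomial.T ((n : ℤ) + 1) + LaurentPolynomial.T (-((n : ℤ) + 1))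

/-- Logarithmic derivatives add over products, and a factor 1 - cw contributes the geometric series
-∑ c^(n+1) w^n. The total is the correction that the shift makes to ε times the power sum series
when ε² = 1. -/
theorem derivative_quadFactor :
    PowerSeries.derivative _ quadFactor = quadFactor * -shiftSeries := by
  have h : shiftSeries = (PowerSeries.mk fun n => (LaurentPolynomial.T 1 : LaurentPolynomial Fock) ^ (n + 1)) +
      PowerSeries.mk fun n => (LaurentPolynomial.T (-1) : LaurentPolynomial Fock) ^ (n + 1) := by
    ext1 n
    simp only [shiftSeries, PowerSeries.coeff_mk, map_add, LaurentPolynomial.T_pow]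
    push_cast
    ring_nf
  rw [quadFactor, Derivation.leibniz, derivative_one_sub_C_mul_X, derivative_one_sub_C_mul_X, h]
  simp only [smul_eq_mul]
  ring

theorem coeff_zero_quadFactor : PowerSeries.coeff 0 quadFactor = 1 := by
  simp [quadFactor]

theorem PowerSeries.derivative_map {R S : Type*} [CommRing R] [CommRing S] (f : R →+* S)
    (F : PowerSeries R) :
    PowerSeries.derivative S (PowerSeries.map f F) =
      PowerSeries.map f (PowerSeries.derivative R F) := by
  ext n
  simp [PowerSeries.coeff_derivative]

theorem map_shiftHom_powerSumSeries (ε : ℚ) :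
    PowerSeries.map (shiftHom ε : Fock →+* LaurentPolynomial Fock) powerSumSeries =
      PowerSeries.map LaurentPolynomial.C powerSumSeries - ε • shiftSeries := by
  ext1 n
  simp [powerSumSeries, shiftSeries, shiftHom]

theorem C_smul_eq_smul {K : Type*} [CommRing K] [Algebra ℚ K] (q : ℚ) (F : PowerSeries K) :
    PowerSeries.C (algebraMap ℚ K q) * F = q • F := by
  ext n
  simp [Algebra.smul_def]

theorem derivative_map_expCreation {K : Type*} [CommRing K] [Algebra ℚ K] (f : Fock →+* K) (δ : ℚ) :
    PowerSeries.derivative K (PowerSeries.map f (expCreation δ)) =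
      PowerSeries.map f (expCreation δ) * δ • PowerSeries.map f powerSumSeries := by
  rw [PowerSeries.derivative_map, derivative_expCreation, map_mul, map_mul, PowerSeries.map_C]
  congr 1
  rw [← C_smul_eq_smul]
  congr 2
  -- A ring has at most one homomorphism from ℚ, so f fixes rational scalars.
  exact RingHom.congr_fun (Subsingleton.elim (f.comp C) (algebraMap ℚ K)) δ

/-- `exp (-ε ∑ ∂/∂p_n (z ^ (-n) + z ^ n))` applied to the series `expCreation ε`. -/
theorem map_shiftHom_expCreation {ε : ℚ} (hε : ε * ε = 1) :
    PowerSeries.map (shiftHom ε : Fock →+* LaurentPolynomial Fock) (expCreation ε) =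
      PowerSeries.map LaurentPolynomial.C (expCreation ε) * quadFactor := by
  refine PowerSeries.eq_of_derivative_eq_mul (derivative_map_expCreation _ _) ?_ ?_
  · rw [Derivation.leibniz, derivative_map_expCreation, derivative_quadFactor,
      map_shiftHom_powerSumSeries, smul_sub, smul_smul, hε, one_smul]
    simp only [smul_eq_mul]
    ring
  · rw [PowerSeries.coeff_mul]
    simp [coeff_zero_expCreation, coeff_zero_quadFactor]

/-- `exp (-ε ∑ ∂/∂p_n (z ^ (-n) + z ^ n))` applied to the series `expCreation (-ε)`. -/
theorem map_shiftHom_expCreation_neg {ε : ℚ} (hε : ε * ε = 1) :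
    PowerSeries.map (shiftHom ε : Fock →+* LaurentPolynomial Fock) (expCreation (-ε)) * quadFactor =
      PowerSeries.map LaurentPolynomial.C (expCreation (-ε)) := by
  refine PowerSeries.eq_of_derivative_eq_mul ?_ (derivative_map_expCreation _ _) ?_
  · rw [Derivation.leibniz, derivative_map_expCreation, derivative_quadFactor,
      map_shiftHom_powerSumSeries, smul_sub, smul_smul, neg_mul, hε, neg_smul, neg_smul, one_smul]
    simp only [smul_eq_mul]
    ring
  · rw [PowerSeries.coeff_mul]
    simp [coeff_zero_expCreation, coeff_zero_quadFactor]

/-! ### The annihilating exponential is the Taylor shift -/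

section Annihilation

variable {F G : FormalDist}

theorem finite_support_pderiv_add (hF : F.support.Finite) (m : ℤ) :
    (Function.support fun n : ℕ+ => pderiv n (F (m + (n : ℤ)))).Finite := by
  refine (hF.preimage (f := fun n : ℕ+ => m + (n : ℤ)) ?_).subset ?_
  · intro a _ b _ h
    simpa using h
  · intro n hn h0
    exact hn (by simp [h0])

theorem finite_support_pderiv_sub (hF : F.support.Finite) (m : ℤ) :
    (Function.support fun n : ℕ+ => pderiv n (F (m - (n : ℤ)))).Finite := by
  refine (hF.preimage (f := fun n : ℕ+ => m - (n : ℤ)) ?_).subset ?_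
  · intro a _ b _ h
    simpa using h
  · intro n hn h0
    exact hn (by simp [h0])

theorem finite_support_annihilation_summand (hF : F.support.Finite) (m : ℤ) :
    (Function.support fun n : ℕ+ => pderiv n (F (m + (n : ℤ)) + F (m - (n : ℤ)))).Finite := by
  simp only [map_add]
  exact ((finite_support_pderiv_add hF m).union (finite_support_pderiv_sub hF m)).subset
    (Function.support_add _ _)

theorem finite_support_annihilation (hF : F.support.Finite) : (annihilation F).support.Finite := by
  -- The coefficient F k contributes only through the variables p_n occurring in it, and only at the
  -- exponents k - n and k + n.
  have hfin : (⋃ k ∈ F.support, ⋃ n ∈ (F k).vars, ({k - (n : ℤ), k + (n : ℤ)} : Set ℤ)).Finite :=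
    hF.biUnion fun k _ => (F k).vars.finite_toSet.biUnion fun n _ => Set.toFinite _
  refine hfin.subset fun m hm => ?_
  by_contra hcon
  simp only [Set.mem_iUnion, not_exists, Set.mem_insert_iff, Set.mem_singleton_iff,
    Function.mem_support] at hcon
  refine hm (finsum_eq_zero_of_forall_eq_zero fun n => ?_)
  have key : ∀ k : ℤ, (m = k - n ∨ m = k + n) → pderiv n (F k) = 0 := by
    intro k hk
    by_cases h0 : F k = 0
    · simp [h0]
    · exact pderiv_eq_zero_of_notMem_vars fun hn => hcon k h0 n hn hk
  rw [map_add, key _ (Or.inl (by ring)), key _ (Or.inr (by ring)), add_zero]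

theorem annihilation_add (hF : F.support.Finite) (hG : G.support.Finite) :
    annihilation (F + G) = annihilation F + annihilation G := by
  funext m
  rw [Pi.add_apply, annihilation, annihilation, annihilation,
    ← finsum_add_distrib (finite_support_annihilation_summand hF m)
      (finite_support_annihilation_summand hG m)]
  refine finsum_congr fun n => ?_
  simp only [Pi.add_apply, map_add]
  ring

theorem annihilation_smul (c : ℚ) : annihilation (c • F) = c • annihilation F := by
  funext m
  rw [Pi.smul_apply, annihilation, annihilation, smul_finsum]
  refine finsum_congr fun n => ?_
  simp only [Pi.smul_apply, map_add, Derivation.map_smul, smul_add]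

theorem annihilation_zero : annihilation 0 = 0 := by
  simpa using annihilation_smul (F := 0) 0

/-- Multiplication of a formal distribution by `z ^ n + z ^ (-n)`. -/
def symmShift (n : ℤ) (F : FormalDist) : FormalDist := fun m => F (m + n) + F (m - n)

theorem finite_support_shift (hF : F.support.Finite) (s : ℤ) :
    (Function.support fun m => F (m + s)).Finite :=
  hF.preimage (add_left_injective s).injOn

theorem symmShift_eq (n : ℤ) (F : FormalDist) :
    symmShift n F = (fun m => F (m + n)) + fun m => F (m + -n) := by
  funext m
  simp [symmShift, sub_eq_add_neg]

theorem finite_support_symmShift (hF : F.support.Finite) (n : ℤ) :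
    (symmShift n F).support.Finite := by
  rw [symmShift_eq]
  exact ((finite_support_shift hF n).union (finite_support_shift hF (-n))).subset
    (Function.support_add _ _)

theorem annihilation_shift (s : ℤ) :
    annihilation (fun m => F (m + s)) = fun m => annihilation F (m + s) := by
  funext m
  refine finsum_congr fun n => ?_
  simp only [add_right_comm m, sub_add_eq_add_sub]

theorem annihilation_symmShift (hF : F.support.Finite) (n : ℤ) :
    annihilation (symmShift n F) = symmShift n (annihilation F) := by
  rw [symmShift_eq, symmShift_eq,
    annihilation_add (finite_support_shift hF n) (finite_support_shift hF (-n)),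
    annihilation_shift, annihilation_shift]

/-- By the Leibniz rule, the commutator of the annihilation operator with p_n is multiplication by
z^n + z^(-n). -/
theorem annihilation_X_mul (hF : F.support.Finite) (n : ℕ+) :
    annihilation (fun m => X n * F m) = (fun m => X n * annihilation F m) + symmShift n F := by
  funext m
  rw [Pi.add_apply, annihilation, annihilation,
    mul_finsum (fun n : ℕ+ => pderiv n (F (m + (n : ℤ)) + F (m - (n : ℤ))))]
  have h2 : symmShift n F m =
      ∑ᶠ k : ℕ+, (if k = n then F (m + (k : ℤ)) + F (m - (k : ℤ)) else 0) := by
    rw [finsum_eq_single _ n (fun k hk => if_neg hk), if_pos rfl]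
    rfl
  rw [h2, ← finsum_add_distrib]
  · refine finsum_congr fun k => ?_
    rw [← mul_add, Derivation.leibniz, pderiv_X, Pi.single_apply]
    split_ifs with h1 h2 h2
    · simp
    · exact absurd h1.symm h2
    · exact absurd h2.symm h1
    · simp
  · refine (finite_support_annihilation_summand hF m).subset fun k hk h0 => hk ?_
    simp only [h0, mul_zero]
  · refine (Set.finite_singleton n).subset fun k hk => ?_
    by_contra h
    exact hk (if_neg h)

theorem finite_support_iterate_annihilation (hF : F.support.Finite) (k : ℕ) :
    (annihilation^[k] F).support.Finite := by
  induction k with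
  | zero => exact hF
  | succ k ih =>
    rw [Function.iterate_succ_apply']
    exact finite_support_annihilation ih

theorem finite_support_X_mul (hF : F.support.Finite) (n : ℕ+) :
    (Function.support fun m => X n * F m).Finite :=
  hF.subset fun m hm h0 => hm (by simp only [h0, mul_zero])

theorem finite_support_smul (hF : F.support.Finite) (c : ℚ) : (c • F).support.Finite :=
  hF.subset fun m hm h0 => hm (by simp only [Pi.smul_apply, h0, smul_zero])

/-- The commutator z^n + z^(-n) itself commutes with the annihilation operator D, so [D^(k+1), p_n]
= (k+1)(z^n + z^(-n)) D^k. -/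
theorem iterate_annihilation_X_mul (hF : F.support.Finite) (n : ℕ+) (k : ℕ) :
    annihilation^[k + 1] (fun m => X n * F m) =
      (fun m => X n * (annihilation^[k + 1] F) m) +
        ((k : ℚ) + 1) • symmShift n (annihilation^[k] F) := by
  induction k with
  | zero => simpa using annihilation_X_mul hF n
  | succ k ih =>
    have hk := finite_support_iterate_annihilation hF k
    have hk1 := finite_support_iterate_annihilation hF (k + 1)
    rw [Function.iterate_succ_apply', ih,
      annihilation_add (finite_support_X_mul hk1 n)
        (finite_support_smul (finite_support_symmShift hk n) _),
      annihilation_X_mul hk1, annihilation_smul, annihilation_symmShift hk,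
      ← Function.iterate_succ_apply' annihilation (k + 1),
      ← Function.iterate_succ_apply' annihilation k, add_assoc]
    congr 1
    push_cast
    simp only [Nat.succ_eq_add_one]
    module

theorem iterate_annihilation_add (hF : F.support.Finite) (hG : G.support.Finite) (k : ℕ) :
    annihilation^[k] (F + G) = annihilation^[k] F + annihilation^[k] G := by
  induction k with
  | zero => rfl
  | succ k ih =>
    rw [Function.iterate_succ_apply', Function.iterate_succ_apply', Function.iterate_succ_apply',
      ih, annihilation_add (finite_support_iterate_annihilation hF k)
        (finite_support_iterate_annihilation hG k)]

end Annihilation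

theorem finite_support_single (f : Fock) :
    (Function.support (Pi.single 0 f : FormalDist)).Finite :=
  (Set.finite_singleton (0 : ℤ)).subset fun m hm => by
    by_contra h
    exact hm (Pi.single_eq_of_ne (M := fun _ => Fock) h f)

theorem single_X_mul (n : ℕ+) (f : Fock) :
    (Pi.single 0 (X n * f) : FormalDist) = fun m => X n * (Pi.single 0 f : FormalDist) m := by
  funext m
  by_cases h : m = 0
  · subst h; simp
  · simp [h]

theorem annihilation_single_C (c : ℚ) : annihilation (Pi.single 0 (C c)) = 0 := by
  funext m
  refine finsum_eq_zero_of_forall_eq_zero fun n => ?_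
  have h : ∀ k : ℤ, pderiv n ((Pi.single 0 (C c) : FormalDist) k) = 0 := by
    intro k
    by_cases h : k = 0
    · subst h; simp
    · simp [h]
  rw [map_add, h, h, add_zero]

/-- Local nilpotence: by the commutator formula, each further factor p_n raises the bound by at most
one. -/
theorem exists_iterate_annihilation_eq_zero (f : Fock) :
    ∃ K, ∀ k ≥ K, annihilation^[k] (Pi.single 0 f) = 0 := by
  induction f using MvPolynomial.induction_on with
  | C c =>
    refine ⟨1, fun k hk => ?_⟩
    obtain ⟨k, rfl⟩ := Nat.exists_eq_add_of_le' hk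
    rw [Function.iterate_succ_apply, annihilation_single_C]
    exact Function.iterate_fixed annihilation_zero k
  | add p q hp hq =>
    obtain ⟨K, hK⟩ := hp
    obtain ⟨L, hL⟩ := hq
    refine ⟨max K L, fun k hk => ?_⟩
    rw [Pi.single_add, iterate_annihilation_add (finite_support_single p) (finite_support_single q),
      hK k (le_of_max_le_left hk), hL k (le_of_max_le_right hk), add_zero]
  | mul_X p n hp =>
    obtain ⟨K, hK⟩ := hp
    refine ⟨K + 1, fun k hk => ?_⟩
    obtain ⟨k, rfl⟩ := Nat.exists_eq_add_of_le' (le_trans (Nat.le_add_left 1 K) hk)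
    rw [mul_comm, single_X_mul, iterate_annihilation_X_mul (finite_support_single p),
      hK k (by omega), hK (k + 1) (by omega)]
    funext m
    simp [symmShift]

theorem expAnnihilation_eq_sum (ε : ℚ) {f : Fock} {K : ℕ}
    (hK : ∀ k ≥ K, annihilation^[k] (Pi.single 0 f) = 0) (m : ℤ) :
    expAnnihilation ε f m = ∑ k ∈ Finset.range K,
      ((-ε) ^ k / (k.factorial : ℚ)) • (annihilation^[k] (Pi.single 0 f)) m := by
  refine finsum_eq_sum_of_support_subset _ fun k hk => ?_
  rw [Finset.coe_range, Set.mem_Iio]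
  by_contra h
  exact hk (by simp only [hK k (not_lt.1 h), Pi.zero_apply, smul_zero])

theorem expAnnihilation_C (ε c : ℚ) : expAnnihilation ε (C c) = (Pi.single 0 (C c) : FormalDist) := by
  funext m
  rw [expAnnihilation_eq_sum ε (K := 1)]
  · simp
  · intro k hk
    obtain ⟨k, rfl⟩ := Nat.exists_eq_add_of_le' hk
    rw [Function.iterate_succ_apply, annihilation_single_C]
    exact Function.iterate_fixed annihilation_zero k

theorem expAnnihilation_add (ε : ℚ) (p q : Fock) :
    expAnnihilation ε (p + q) = expAnnihilation ε p + expAnnihilation ε q := by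
  obtain ⟨K, hK⟩ := exists_iterate_annihilation_eq_zero p
  obtain ⟨L, hL⟩ := exists_iterate_annihilation_eq_zero q
  have hadd := iterate_annihilation_add (finite_support_single p) (finite_support_single q)
  have hK' : ∀ k ≥ max K L, annihilation^[k] (Pi.single 0 p) = 0 :=
    fun k hk => hK k (le_of_max_le_left hk)
  have hL' : ∀ k ≥ max K L, annihilation^[k] (Pi.single 0 q) = 0 :=
    fun k hk => hL k (le_of_max_le_right hk)
  funext m
  rw [Pi.add_apply, expAnnihilation_eq_sum ε hK', expAnnihilation_eq_sum ε hL',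
    expAnnihilation_eq_sum ε (K := max K L), ← Finset.sum_add_distrib]
  · refine Finset.sum_congr rfl fun k _ => ?_
    rw [Pi.single_add, hadd, Pi.add_apply, smul_add]
  · intro k hk
    rw [Pi.single_add, hadd, hK' k hk, hL' k hk, add_zero]

/-- Conjugating p_n by exp(-εD) stops at the first commutator, since that commutator is central. In
the series, the factor k + 1 of [D^(k+1), p_n] cancels against (k+1)!. -/
theorem expAnnihilation_X_mul (ε : ℚ) (n : ℕ+) (f : Fock) (m : ℤ) :
    expAnnihilation ε (X n * f) m = X n * expAnnihilation ε f m -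
      ε • (expAnnihilation ε f (m + n) + expAnnihilation ε f (m - n)) := by
  obtain ⟨K, hK⟩ := exists_iterate_annihilation_eq_zero f
  have hK1 : ∀ k ≥ K + 1, annihilation^[k] (Pi.single 0 f) = 0 := fun k hk => hK k (by omega)
  have hmul := iterate_annihilation_X_mul (finite_support_single f) n
  rw [expAnnihilation_eq_sum ε hK1 m, expAnnihilation_eq_sum ε hK (m + n),
    expAnnihilation_eq_sum ε hK (m - n), expAnnihilation_eq_sum ε (K := K + 1)]
  · rw [Finset.sum_range_succ', Finset.sum_range_succ', ← Finset.sum_add_distrib, Finset.smul_sum,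
      mul_add, Finset.mul_sum, add_sub_right_comm, ← Finset.sum_sub_distrib]
    congr 1
    · refine Finset.sum_congr rfl fun k _ => ?_
      have h1 : ((k : ℚ) + 1) ≠ 0 := by positivity
      have h2 : ((k.factorial : ℕ) : ℚ) ≠ 0 := by positivity
      have h3 : (-ε) ^ (k + 1) / ((k + 1).factorial : ℚ) * ((k : ℚ) + 1) =
          -(ε * ((-ε) ^ k / (k.factorial : ℚ))) := by
        rw [Nat.factorial_succ]
        push_cast
        field_simp
        ring
      rw [single_X_mul, hmul, Pi.add_apply, Pi.smul_apply, symmShift,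
        smul_add ((-ε) ^ (k + 1) / ((k + 1).factorial : ℚ)), smul_smul, h3, ← smul_add, smul_smul ε,
        mul_smul_comm, neg_smul, ← sub_eq_add_neg]
    · rw [Function.iterate_zero, id, id, single_X_mul, mul_smul_comm]
  · intro k hk
    obtain ⟨k, rfl⟩ := Nat.exists_eq_add_of_le' (le_trans (Nat.le_add_left 1 K) hk)
    rw [single_X_mul, hmul, hK k (by omega), hK (k + 1) (by omega)]
    funext m
    simp [symmShift]

theorem coeff_T_mul {R : Type*} [CommSemiring R] (n m : ℤ) (L : LaurentPolynomial R) :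
    (LaurentPolynomial.T n * L).coeff m = L.coeff (m - n) := by
  rw [LaurentPolynomial.T, AddMonoidAlgebra.coeff_single_mul_apply, one_mul, neg_add_eq_sub]

theorem coeff_C_mul_laurent {R : Type*} [CommSemiring R] (r : R) (m : ℤ) (L : LaurentPolynomial R) :
    (LaurentPolynomial.C r * L).coeff m = r * L.coeff m := by
  rw [← LaurentPolynomial.smul_eq_C_mul, AddMonoidAlgebra.coeff_smul_apply, smul_eq_mul]

theorem shiftHom_X_mul (ε : ℚ) (n : ℕ+) (f : Fock) :
    shiftHom ε (X n * f) = LaurentPolynomial.C (X n) * shiftHom ε f -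
      ε • (LaurentPolynomial.T (n : ℤ) * shiftHom ε f +
        LaurentPolynomial.T (-(n : ℤ)) * shiftHom ε f) := by
  rw [map_mul, shiftHom, aeval_X, sub_mul, smul_mul_assoc, add_mul]

/-- Both sides agree on constants, are additive and obey the same recursion under multiplication by
p_n. -/
theorem expAnnihilation_eq_coeff_shiftHom (ε : ℚ) (f : Fock) (m : ℤ) :
    expAnnihilation ε f m = (shiftHom ε f).coeff m := by
  induction f using MvPolynomial.induction_on generalizing m with
  | C c =>
    have h : shiftHom ε (C c) = LaurentPolynomial.C (C c) := (shiftHom ε).commutes c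
    rw [h, expAnnihilation_C, LaurentPolynomial.C_apply, Pi.single_apply]
  | add p q hp hq =>
    rw [expAnnihilation_add, map_add, Pi.add_apply, hp, hq]
    rfl
  | mul_X p n hp =>
    rw [mul_comm, expAnnihilation_X_mul, shiftHom_X_mul, hp, hp, hp, AddMonoidAlgebra.coeff_sub,
      Finsupp.sub_apply, coeff_C_mul_laurent, AddMonoidAlgebra.coeff_smul_apply,
      AddMonoidAlgebra.coeff_add, Finsupp.add_apply, coeff_T_mul, coeff_T_mul, sub_neg_eq_add,
      add_comm ((shiftHom ε p).coeff (m - n))]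

/-! ### Modes of the vertex operators and their values on the g_n -/

/-- The coefficient of `z ^ n` in `exp (∑ ε (p_n / n) z ^ n)`, for an integer `n`. -/
def genCoeff (ε : ℚ) (n : ℤ) : Fock :=
  if 0 ≤ n then PowerSeries.coeff n.toNat (expCreation ε) else 0

theorem genCoeff_natCast (ε : ℚ) (n : ℕ) :
    genCoeff ε n = PowerSeries.coeff n (expCreation ε) := by
  simp [genCoeff]

theorem genCoeff_of_neg (ε : ℚ) {n : ℤ} (hn : n < 0) : genCoeff ε n = 0 :=
  if_neg (not_le.2 hn)

theorem genCoeff_zero (ε : ℚ) : genCoeff ε 0 = 1 := by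
  simpa [coeff_zero_expCreation] using genCoeff_natCast ε 0

theorem finite_support_creationMul (ε : ℚ) (a : ℤ) (L : LaurentPolynomial Fock) :
    (Function.support fun i : ℕ =>
      PowerSeries.coeff i (expCreation ε) * L.coeff (a - (i : ℤ))).Finite := by
  refine (L.coeff.hasFiniteSupport.preimage (f := fun i : ℕ => a - (i : ℤ)) ?_).subset ?_
  · intro i _ j _ h
    simpa using h
  · intro i hi h0
    exact hi (by simp only [h0, mul_zero])

/-- The coefficient of `z ^ a` in the product of `expCreation ε` with a Laurent polynomial. -/
def creationMul (ε : ℚ) (a : ℤ) : LaurentPolynomial Fock →ₗ[Fock] Fock where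
  toFun L := ∑ᶠ i : ℕ, PowerSeries.coeff i (expCreation ε) * L.coeff (a - (i : ℤ))
  map_add' L M := by
    rw [← finsum_add_distrib (finite_support_creationMul ε a L) (finite_support_creationMul ε a M)]
    refine finsum_congr fun i => ?_
    rw [AddMonoidAlgebra.coeff_add, Finsupp.add_apply, mul_add]
  map_smul' r L := by
    rw [RingHom.id_apply, smul_eq_mul, mul_finsum]
    refine finsum_congr fun i => ?_
    rw [AddMonoidAlgebra.coeff_smul_apply, smul_eq_mul, mul_left_comm]

theorem creationMul_T_mul (ε : ℚ) (a n : ℤ) (L : LaurentPolynomial Fock) :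
    creationMul ε a (LaurentPolynomial.T n * L) = creationMul ε (a - n) L := by
  refine finsum_congr fun i => ?_
  rw [coeff_T_mul, sub_right_comm]

theorem creationMul_C_mul (ε : ℚ) (a : ℤ) (r : Fock) (L : LaurentPolynomial Fock) :
    creationMul ε a (LaurentPolynomial.C r * L) = r * creationMul ε a L := by
  rw [← LaurentPolynomial.smul_eq_C_mul, map_smul, smul_eq_mul]

theorem creationMul_one (ε : ℚ) (a : ℤ) : creationMul ε a 1 = genCoeff ε a := by
  change ∑ᶠ i : ℕ, PowerSeries.coeff i (expCreation ε) *
    (LaurentPolynomial.T 0 : LaurentPolynomial Fock).coeff (a - (i : ℤ)) = _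
  by_cases ha : 0 ≤ a
  · obtain ⟨n, rfl⟩ := Int.eq_ofNat_of_zero_le ha
    rw [finsum_eq_single _ n, genCoeff_natCast]
    · rw [LaurentPolynomial.T_apply, if_pos (by ring), mul_one]
    · intro i hi
      rw [LaurentPolynomial.T_apply, if_neg (by omega), mul_zero]
  · rw [genCoeff_of_neg ε (not_le.1 ha)]
    refine finsum_eq_zero_of_forall_eq_zero fun i => ?_
    rw [LaurentPolynomial.T_apply, if_neg (by omega), mul_zero]

theorem creationMul_C (ε : ℚ) (a : ℤ) (r : Fock) :
    creationMul ε a (LaurentPolynomial.C r) = r * genCoeff ε a := by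
  rw [← mul_one (LaurentPolynomial.C r), creationMul_C_mul, creationMul_one]

/-- The coefficient of `z ^ a` in `vertexOperator ε`, as a linear map. -/
def vertexMode (ε : ℚ) (a : ℤ) : Fock →ₗ[ℚ] Fock :=
  (creationMul ε a).restrictScalars ℚ ∘ₗ (shiftHom ε).toLinearMap

theorem vertexMode_apply (ε : ℚ) (a : ℤ) (f : Fock) :
    vertexMode ε a f = creationMul ε a (shiftHom ε f) := rfl

theorem vertexOperator_eq_vertexMode (ε : ℚ) (f : Fock) (a : ℤ) :
    vertexOperator ε f a = vertexMode ε a f := by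
  refine finsum_congr fun i => ?_
  rw [expAnnihilation_eq_coeff_shiftHom]
  rfl

theorem vertexMode_one (ε : ℚ) (a : ℤ) : vertexMode ε a 1 = genCoeff ε a := by
  rw [vertexMode_apply, map_one, creationMul_one]

theorem vertexMode_X_mul (ε : ℚ) (a : ℤ) (n : ℕ+) (f : Fock) :
    vertexMode ε a (X n * f) = X n * vertexMode ε a f -
      ε • (vertexMode ε (a - n) f + vertexMode ε (a + n) f) := by
  simp only [vertexMode_apply]
  rw [shiftHom_X_mul, map_sub, creationMul_C_mul, LinearMap.map_smul_of_tower, map_add,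
    creationMul_T_mul, creationMul_T_mul, sub_neg_eq_add]

theorem quadFactor_eq : quadFactor = 1 -
    PowerSeries.C (LaurentPolynomial.T 1 + LaurentPolynomial.T (-1)) * PowerSeries.X +
      PowerSeries.X * PowerSeries.X := by
  have h : PowerSeries.C (LaurentPolynomial.T 1) * PowerSeries.C (LaurentPolynomial.T (-1)) =
      (1 : PowerSeries (LaurentPolynomial Fock)) := by
    rw [← map_mul, ← LaurentPolynomial.T_add, add_neg_cancel, LaurentPolynomial.T_zero, map_one]
  rw [quadFactor, map_add]
  linear_combination (PowerSeries.X * PowerSeries.X) * h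

theorem coeff_mul_quadFactor (F : PowerSeries (LaurentPolynomial Fock))
    (u : ℤ → LaurentPolynomial Fock) (hneg : ∀ n < 0, u n = 0)
    (hu : ∀ n : ℕ, u n = PowerSeries.coeff n F) (n : ℕ) :
    PowerSeries.coeff n (F * quadFactor) =
      u n - (LaurentPolynomial.T 1 + LaurentPolynomial.T (-1)) * u ((n : ℤ) - 1) + u ((n : ℤ) - 2) := by
  have h : F * quadFactor = F -
      PowerSeries.C (LaurentPolynomial.T 1 + LaurentPolynomial.T (-1)) * (PowerSeries.X * F) +
      PowerSeries.X * (PowerSeries.X * F) := by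
    rw [quadFactor_eq]; ring
  rw [h, map_add, map_sub, PowerSeries.coeff_C_mul, hu]
  match n with
  | 0 => rw [hneg _ (by norm_num), hneg _ (by norm_num)]; simp
  | 1 =>
    rw [hneg (((1 : ℕ) : ℤ) - 2) (by norm_num), PowerSeries.coeff_succ_X_mul,
      PowerSeries.coeff_succ_X_mul, show ((1 : ℕ) : ℤ) - 1 = (0 : ℕ) by norm_num, hu]
    simp
  | n + 2 =>
    rw [PowerSeries.coeff_succ_X_mul, PowerSeries.coeff_succ_X_mul, PowerSeries.coeff_succ_X_mul,
      show ((n + 2 : ℕ) : ℤ) - 1 = (n + 1 : ℕ) by push_cast; ring,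
      show ((n + 2 : ℕ) : ℤ) - 2 = (n : ℕ) by push_cast; ring, hu, hu]

theorem shiftHom_genCoeff {ε : ℚ} (hε : ε * ε = 1) (n : ℤ) :
    shiftHom ε (genCoeff ε n) = LaurentPolynomial.C (genCoeff ε n) -
      (LaurentPolynomial.T 1 + LaurentPolynomial.T (-1)) * LaurentPolynomial.C (genCoeff ε (n - 1)) +
      LaurentPolynomial.C (genCoeff ε (n - 2)) := by
  by_cases hn : 0 ≤ n
  · obtain ⟨n, rfl⟩ := Int.eq_ofNat_of_zero_le hn
    have h := congrArg (PowerSeries.coeff n) (map_shiftHom_expCreation hε)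
    rw [coeff_mul_quadFactor _ (fun n => LaurentPolynomial.C (genCoeff ε n)), PowerSeries.coeff_map]
      at h
    · rw [genCoeff_natCast] at h ⊢
      exact h
    · intro n hn
      simp only [genCoeff_of_neg ε hn, map_zero]
    · intro n
      rw [genCoeff_natCast, PowerSeries.coeff_map]
  · rw [genCoeff_of_neg ε (by omega), genCoeff_of_neg ε (by omega), genCoeff_of_neg ε (by omega)]
    simp

/-- For the opposite sign the quadratic factor sits in the denominator. Clearing it yields a
three-term relation, which avoids expanding the inverse. -/
theorem shiftHom_genCoeff_neg {ε : ℚ} (hε : ε * ε = 1) (n : ℤ) :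
    shiftHom ε (genCoeff (-ε) n) -
      (LaurentPolynomial.T 1 + LaurentPolynomial.T (-1)) * shiftHom ε (genCoeff (-ε) (n - 1)) +
      shiftHom ε (genCoeff (-ε) (n - 2)) = LaurentPolynomial.C (genCoeff (-ε) n) := by
  by_cases hn : 0 ≤ n
  · obtain ⟨n, rfl⟩ := Int.eq_ofNat_of_zero_le hn
    have h := congrArg (PowerSeries.coeff n) (map_shiftHom_expCreation_neg hε)
    rw [coeff_mul_quadFactor _ (fun n => shiftHom ε (genCoeff (-ε) n)), PowerSeries.coeff_map]
      at h
    · rw [genCoeff_natCast] at h ⊢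
      exact h
    · intro n hn
      simp only [genCoeff_of_neg (-ε) hn, map_zero]
    · intro n
      rw [genCoeff_natCast, PowerSeries.coeff_map]
      rfl
  · rw [genCoeff_of_neg (-ε) (by omega), genCoeff_of_neg (-ε) (by omega),
      genCoeff_of_neg (-ε) (by omega)]
    simp

/-- This is the coefficient of z^a after multiplying the preceding relation by the creation series.
The right side is symmetric under exchanging (ε, a) with (-ε, b), which is what lets the two orders
of composition be compared. -/
theorem vertexMode_genCoeff_neg {ε : ℚ} (hε : ε * ε = 1) (a b : ℤ) :
    vertexMode ε a (genCoeff (-ε) b) - vertexMode ε (a - 1) (genCoeff (-ε) (b - 1)) -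
      vertexMode ε (a + 1) (genCoeff (-ε) (b - 1)) + vertexMode ε a (genCoeff (-ε) (b - 2)) =
      genCoeff ε a * genCoeff (-ε) b := by
  have h := congrArg (creationMul ε a) (shiftHom_genCoeff_neg hε b)
  rw [map_add, map_sub, add_mul, map_add, creationMul_T_mul, creationMul_T_mul, creationMul_C,
    sub_neg_eq_add] at h
  simp only [vertexMode_apply]
  linear_combination h

/-- The convolution identity `∑ h_i (-1) ^ j e_j = 0`, where `i + j = n > 0`. -/
theorem sum_genCoeff_mul_genCoeff_neg (ε : ℚ) {n : ℕ} (hn : 0 < n) :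
    ∑ i ∈ Finset.range (n + 1), genCoeff ε i * genCoeff (-ε) ((n : ℤ) - i) = 0 := by
  have h := congrArg (PowerSeries.coeff n) (expCreation_mul_expCreation_neg ε)
  rw [PowerSeries.coeff_mul, PowerSeries.coeff_one, if_neg hn.ne',
    Finset.Nat.sum_antidiagonal_eq_sum_range_succ_mk] at h
  rw [← h]
  refine Finset.sum_congr rfl fun i hi => ?_
  rw [← Nat.cast_sub (Nat.lt_succ_iff.1 (Finset.mem_range.1 hi)), genCoeff_natCast, genCoeff_natCast]

/-! ### Commutation relations -/

/-- `Y_{-a} W*_b + W*_{b+1} Y_{-(a-1)}`. -/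
def mixedAnticommutator (a b : ℤ) (f : Fock) : Fock :=
  vertexMode 1 a (vertexMode (-1) b f) + vertexMode (-1) (b + 1) (vertexMode 1 (a - 1) f)

/-- Both products in the anticommutator pick up the same index shifts, since every relation used for
a mode is invariant under translating its index. Hence a linear identity valid for all a, b
propagates from f to p_n f. -/
theorem mixedAnticommutator_X_mul (a b : ℤ) (n : ℕ+) (f : Fock) :
    mixedAnticommutator a b (X n * f) = X n * mixedAnticommutator a b f -
      mixedAnticommutator (a - n) b f - mixedAnticommutator (a + n) b f +
      mixedAnticommutator a (b - n) f + mixedAnticommutator a (b + n) f := by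
  simp only [mixedAnticommutator, vertexMode_X_mul, map_sub, map_add, map_smul]
  rw [show a - 1 - (n : ℤ) = a - n - 1 by ring, show a - 1 + (n : ℤ) = a + n - 1 by ring,
    show b + 1 - (n : ℤ) = b - n + 1 by ring, show b + 1 + (n : ℤ) = b + n + 1 by ring]
  simp only [one_smul, neg_smul]
  ring

theorem mixedAnticommutator_one (a b : ℤ) : mixedAnticommutator a b 1 =
    vertexMode 1 a (genCoeff (-1) b) + vertexMode (-1) (b + 1) (genCoeff 1 (a - 1)) := by
  rw [mixedAnticommutator, vertexMode_one, vertexMode_one]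

theorem mixedAnticommutator_add (a b : ℤ) (f g : Fock) : mixedAnticommutator a b (f + g) =
    mixedAnticommutator a b f + mixedAnticommutator a b g := by
  simp only [mixedAnticommutator, map_add]
  ring

theorem mixedAnticommutator_C (a b : ℤ) (c : ℚ) : mixedAnticommutator a b (C c) =
    c • mixedAnticommutator a b 1 := by
  rw [← mul_one (C c), ← MvPolynomial.smul_eq_C_mul]
  simp only [mixedAnticommutator, map_smul, smul_add]

theorem vertexMode_one_genCoeff (a b : ℤ) :
    vertexMode 1 a (genCoeff (-1) b) - vertexMode 1 (a - 1) (genCoeff (-1) (b - 1)) -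
      vertexMode 1 (a + 1) (genCoeff (-1) (b - 1)) + vertexMode 1 a (genCoeff (-1) (b - 2)) =
      genCoeff 1 a * genCoeff (-1) b :=
  vertexMode_genCoeff_neg (by norm_num) a b

theorem vertexMode_neg_one_genCoeff (a b : ℤ) :
    vertexMode (-1) b (genCoeff 1 a) - vertexMode (-1) (b - 1) (genCoeff 1 (a - 1)) -
      vertexMode (-1) (b + 1) (genCoeff 1 (a - 1)) + vertexMode (-1) b (genCoeff 1 (a - 2)) =
      genCoeff 1 a * genCoeff (-1) b := by
  have h := vertexMode_genCoeff_neg (ε := -1) (by norm_num) b a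
  rw [neg_neg] at h
  rw [h, mul_comm]

/-- The relations for Y on the (-1)^n e_n and for W* on the h_n have the same right side. Their
difference says that the defect between the two sides at (a, b) equals the defect at (a-1, b-1).
Descending the diagonal reaches negative indices, where everything vanishes. -/
theorem mixedAnticommutator_one_succ_aux (N : ℕ) : ∀ a b : ℤ, a < N → b < N →
    mixedAnticommutator a b 1 = mixedAnticommutator (a + 1) (b - 1) 1 := by
  induction N with
  | zero =>
    intro a b ha hb
    simp only [mixedAnticommutator_one]
    rw [genCoeff_of_neg (-1) (by omega), genCoeff_of_neg 1 (by omega),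
      genCoeff_of_neg (-1) (by omega), genCoeff_of_neg 1 (by omega)]
    simp
  | succ N ih =>
    intro a b ha hb
    have h := ih (a - 1) (b - 1) (by omega) (by omega)
    have h1 := vertexMode_one_genCoeff a b
    have h2 := vertexMode_neg_one_genCoeff a b
    simp only [mixedAnticommutator_one] at h ⊢
    ring_nf at h h1 h2 ⊢
    linear_combination h + h1 - h2

theorem mixedAnticommutator_succ (f : Fock) (a b : ℤ) :
    mixedAnticommutator a b f = mixedAnticommutator (a + 1) (b - 1) f := by
  induction f using MvPolynomial.induction_on generalizing a b with
  | C c =>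
    rw [mixedAnticommutator_C, mixedAnticommutator_C,
      mixedAnticommutator_one_succ_aux (max (a + 1) (b + 1)).toNat a b (by omega) (by omega)]
  | add p q hp hq => rw [mixedAnticommutator_add, mixedAnticommutator_add, hp, hq]
  | mul_X p n hp =>
    rw [mul_comm, mixedAnticommutator_X_mul, mixedAnticommutator_X_mul, hp a b, hp (a - n) b,
      hp (a + n) b, hp a (b - n), hp a (b + n)]
    ring_nf

/-- `mixedAnticommutator a b` depends on `a + b` only. -/
theorem mixedAnticommutator_congr (f : Fock) {a b a' b' : ℤ} (h : a + b = a' + b') :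
    mixedAnticommutator a b f = mixedAnticommutator a' b' f := by
  have key : ∀ (n : ℕ) (a b : ℤ),
      mixedAnticommutator a b f = mixedAnticommutator (a + n) (b - n) f := by
    intro n
    induction n with
    | zero => intro a b; simp
    | succ n ih =>
      intro a b
      rw [ih, mixedAnticommutator_succ]
      push_cast
      ring_nf
  rcases le_total a a' with h1 | h1
  · rw [key (a' - a).toNat a b]
    congr 1 <;> omega
  · rw [key (a - a').toNat a' b']
    congr 1 <;> omega

/-- The relation for W* on the h_n writes each product as a difference U(a) - U(a-1), where U(a) is
the right side at n = a, and U(-1) = 0. -/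
theorem sum_genCoeff_telescope (c : ℤ) (n : ℕ) :
    ∑ i ∈ Finset.range (n + 1), genCoeff 1 i * genCoeff (-1) (c - i) =
      vertexMode (-1) (c - n) (genCoeff 1 n) - vertexMode (-1) (c - n - 1) (genCoeff 1 ((n : ℤ) - 1)) := by
  have hstep : ∀ a : ℤ, genCoeff 1 a * genCoeff (-1) (c - a) =
      (vertexMode (-1) (c - a) (genCoeff 1 a) - vertexMode (-1) (c - a - 1) (genCoeff 1 (a - 1))) -
      (vertexMode (-1) (c - (a - 1)) (genCoeff 1 (a - 1)) -
        vertexMode (-1) (c - (a - 1) - 1) (genCoeff 1 (a - 1 - 1))) := by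
    intro a
    rw [← vertexMode_neg_one_genCoeff]
    ring_nf
  induction n with
  | zero =>
    rw [Finset.sum_range_one, hstep]
    simp [genCoeff_of_neg]
  | succ n ih =>
    rw [Finset.sum_range_succ, ih, hstep]
    push_cast
    ring_nf

theorem mixedAnticommutator_sub_two_one {a b : ℤ} (h : 0 < a + b) :
    mixedAnticommutator a b 1 = mixedAnticommutator a (b - 2) 1 := by
  obtain ⟨n, hn⟩ := Int.eq_ofNat_of_zero_le h.le
  have hs := sum_genCoeff_mul_genCoeff_neg 1 (n := n) (by omega)
  rw [sum_genCoeff_telescope, sub_self, zero_sub] at hs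
  -- Among the pairs with a given sum, b = -1 and b = -2 are chosen so that the first summand
  -- vanishes. What remains is the vanishing of the telescoped sum at c = n.
  rw [mixedAnticommutator_congr 1 (show a + b = (n + 1) + -1 by omega),
    mixedAnticommutator_congr 1 (show a + (b - 2) = n + -2 by omega), mixedAnticommutator_one,
    mixedAnticommutator_one, genCoeff_of_neg (-1) (n := -1) (by norm_num),
    genCoeff_of_neg (-1) (n := -2) (by norm_num), add_sub_cancel_right, map_zero, map_zero,
    zero_add, zero_add, show (-1 : ℤ) + 1 = 0 by norm_num, show (-2 : ℤ) + 1 = 0 - 1 by norm_num]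
  exact sub_eq_zero.1 hs

/-- As M depends only on a + b, the four shifted terms cancel in pairs: M commutes with
multiplication by p_n, and the identity on 1 extends to all of Λ. -/
theorem mixedAnticommutator_sub_two (f : Fock) {a b : ℤ} (h : 0 < a + b) :
    mixedAnticommutator a b f = mixedAnticommutator a (b - 2) f := by
  induction f using MvPolynomial.induction_on with
  | C c => rw [mixedAnticommutator_C, mixedAnticommutator_C, mixedAnticommutator_sub_two_one h]
  | add p q hp hq => rw [mixedAnticommutator_add, mixedAnticommutator_add, hp, hq]
  | mul_X p n hp =>
    rw [mul_comm, mixedAnticommutator_X_mul, mixedAnticommutator_X_mul, hp,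
      mixedAnticommutator_congr p (show a - n + b = a + (b - n) by ring),
      mixedAnticommutator_congr p (show a + n + b = a + (b + n) by ring),
      mixedAnticommutator_congr p (show a - n + (b - 2) = a + (b - 2 - n) by ring),
      mixedAnticommutator_congr p (show a + n + (b - 2) = a + (b - 2 + n) by ring)]
    ring

/-- The coefficient of `z ^ a` in `(1 - z ^ 2) vertexOperator ε`, as a linear map. -/
def twistedMode (ε : ℚ) (a : ℤ) : Fock →ₗ[ℚ] Fock := vertexMode ε a - vertexMode ε (a - 2)

theorem twistedMode_apply (ε : ℚ) (a : ℤ) (f : Fock) :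
    twistedMode ε a f = vertexMode ε a f - vertexMode ε (a - 2) f := rfl

/-- `Y_{-a} Y*_b = - Y*_{b+1} Y_{-(a-1)}` for `a + b > 0`. -/
theorem vertexMode_twistedMode (f : Fock) {a b : ℤ} (h : 0 < a + b) :
    vertexMode 1 a (twistedMode (-1) b f) =
      -twistedMode (-1) (b + 1) (vertexMode 1 (a - 1) f) := by
  have h1 := mixedAnticommutator_sub_two f h
  simp only [mixedAnticommutator] at h1
  rw [show b - 2 + 1 = b + 1 - 2 by ring] at h1
  simp only [twistedMode_apply, map_sub]
  linear_combination h1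

/-- `W_{-a} W*_b = - W*_{b+1} W_{-(a-1)}` for `a + b > 0`. -/
theorem twistedMode_vertexMode (f : Fock) {a b : ℤ} (h : 0 < a + b) :
    twistedMode 1 a (vertexMode (-1) b f) =
      -vertexMode (-1) (b + 1) (twistedMode 1 (a - 1) f) := by
  have h1 := mixedAnticommutator_sub_two f h
  rw [mixedAnticommutator_congr f (a' := a - 2) (b' := b) (by ring : a + (b - 2) = a - 2 + b)] at h1
  simp only [mixedAnticommutator] at h1
  rw [show a - 2 - 1 = a - 1 - 2 by ring] at h1
  simp only [twistedMode_apply, map_sub]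
  linear_combination h1

theorem vertexMode_zero_one (ε : ℚ) : vertexMode ε 0 1 = 1 := by
  rw [vertexMode_one, genCoeff_zero]

theorem twistedMode_zero_one (ε : ℚ) : twistedMode ε 0 1 = 1 := by
  rw [twistedMode_apply, vertexMode_one, vertexMode_one, genCoeff_zero,
    genCoeff_of_neg ε (by norm_num), sub_zero]

theorem modeY_eq (n : ℤ) : modeY (-n) = vertexMode 1 n := by
  funext f
  rw [modeY, symplecticY, vertexOperator_eq_vertexMode, neg_neg]

theorem modeW_eq (n : ℤ) : modeW (-n) = twistedMode 1 n := by
  funext f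
  rw [modeW, orthogonalW, oneSubSqMul, symplecticY, vertexOperator_eq_vertexMode,
    vertexOperator_eq_vertexMode, neg_neg, twistedMode_apply]

theorem modeWStar_eq (n : ℤ) : modeWStar n = vertexMode (-1) n := by
  funext f
  rw [modeWStar, orthogonalWStar, vertexOperator_eq_vertexMode]

theorem modeYStar_eq (n : ℤ) : modeYStar n = twistedMode (-1) n := by
  funext f
  rw [modeYStar, symplecticYStar, oneSubSqMul, orthogonalWStar, vertexOperator_eq_vertexMode,
    vertexOperator_eq_vertexMode, twistedMode_apply]

/-! ### Conjugate partitions -/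

/-- The vector obtained by applying the operators `op r`, for `r` in a list, to `1`. -/
def modeVector (op : ℤ → Fock →ₗ[ℚ] Fock) (w : List ℕ) : Fock :=
  w.foldr (fun r v => op r v) 1

theorem modeVector_nil (op : ℤ → Fock →ₗ[ℚ] Fock) : modeVector op [] = 1 := rfl

theorem modeVector_cons (op : ℤ → Fock →ₗ[ℚ] Fock) (a : ℕ) (w : List ℕ) :
    modeVector op (a :: w) = op a (modeVector op w) := rfl

theorem vectorY_eq (lam : YoungDiagram) : vectorY lam = modeVector (vertexMode 1) lam.rowLens := by
  simp only [vectorY, modeVector, modeY_eq]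

theorem vectorW_eq (lam : YoungDiagram) : vectorW lam = modeVector (twistedMode 1) lam.rowLens := by
  simp only [vectorW, modeVector, modeW_eq]

theorem vectorYStar_eq (lam : YoungDiagram) :
    vectorYStar lam = modeVector (twistedMode (-1)) lam.rowLens := by
  simp only [vectorYStar, modeVector, modeYStar_eq]

theorem vectorWStar_eq (lam : YoungDiagram) :
    vectorWStar lam = modeVector (vertexMode (-1)) lam.rowLens := by
  simp only [vectorWStar, modeVector, modeWStar_eq]

/-- The index of `op` always equals the number of factors still to be crossed. It is thus positive
at each exchange, as the relation requires, and zero on reaching 1. -/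
theorem op_length_modeVector {op op' : ℤ → Fock →ₗ[ℚ] Fock} (h0 : op 0 1 = 1)
    (hop : ∀ (a b : ℤ) (f : Fock), 0 < a + b → op a (op' b f) = -op' (b + 1) (op (a - 1) f))
    (w : List ℕ) :
    op w.length (modeVector op' w) = (-1 : Fock) ^ w.length * modeVector op' (w.map (· + 1)) := by
  induction w with
  | nil => simpa [modeVector] using h0
  | cons b w ih =>
    rw [modeVector_cons, hop _ _ _ (by simp; omega), List.length_cons, Nat.cast_succ,
      add_sub_cancel_right, ih, List.map_cons, modeVector_cons, Nat.cast_succ]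
    have h : (-1 : Fock) ^ w.length = C ((-1) ^ w.length) := by simp
    rw [pow_succ, h, ← MvPolynomial.smul_eq_C_mul, map_smul, MvPolynomial.smul_eq_C_mul]
    ring

theorem modeVector_append_replicate_zero {op : ℤ → Fock →ₗ[ℚ] Fock} (h0 : op 0 1 = 1)
    (w : List ℕ) (k : ℕ) : modeVector op (w ++ List.replicate k 0) = modeVector op w := by
  induction w with
  | nil =>
    induction k with
    | zero => rfl
    | succ k ih =>
      rw [List.replicate_succ, List.nil_append, modeVector_cons, ← List.nil_append (List.replicate k 0),
        ih, modeVector_nil]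
      exact h0
  | cons b w ih => rw [List.cons_append, modeVector_cons, modeVector_cons, ih]

/-- The numbers `#{x ∈ w | j < x}` for `j < N`: if `w` is a partition with parts at most `N`, these
are the parts of the conjugate partition, followed by zeros. -/
def conjugateParts (w : List ℕ) (N : ℕ) : List ℕ :=
  (List.range N).map fun j => w.countP fun x => decide (j < x)

theorem conjugateParts_eq_append {w : List ℕ} {a N : ℕ} (hw : ∀ x ∈ w, x ≤ a) (hN : a ≤ N) :
    conjugateParts w N = conjugateParts w a ++ List.replicate (N - a) 0 := by
  obtain ⟨k, rfl⟩ := Nat.exists_eq_add_of_le hN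
  rw [conjugateParts, conjugateParts, List.range_add, List.map_append, List.map_map,
    Nat.add_sub_cancel_left]
  congr 1
  rw [List.eq_replicate_iff]
  refine ⟨by simp, ?_⟩
  simp only [List.mem_map, List.mem_range, Function.comp_apply]
  rintro _ ⟨j, -, rfl⟩
  rw [List.countP_eq_zero]
  intro x hx
  have := hw x hx
  simp; omega

theorem conjugateParts_cons (w : List ℕ) (a : ℕ) :
    conjugateParts (a :: w) a = (conjugateParts w a).map (· + 1) := by
  rw [conjugateParts, conjugateParts, List.map_map]
  refine List.map_congr_left fun j hj => ?_
  rw [List.countP_cons, if_pos (by simpa using hj)]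
  rfl

/-- Induction on the rows: a new first row of length a adds one box to each of the first a columns.
The conjugate of the remaining rows is padded by zeros to length exactly a, so that
`op_length_modeVector` applies. -/
theorem modeVector_eq_conjugate {op op' : ℤ → Fock →ₗ[ℚ] Fock} (h0 : op 0 1 = 1)
    (h0' : op' 0 1 = 1)
    (hop : ∀ (a b : ℤ) (f : Fock), 0 < a + b → op a (op' b f) = -op' (b + 1) (op (a - 1) f))
    (w : List ℕ) (hw : w.Pairwise (· ≥ ·)) (N : ℕ) (hN : ∀ x ∈ w, x ≤ N) :
    modeVector op w = (-1 : Fock) ^ w.sum * modeVector op' (conjugateParts w N) := by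
  induction w generalizing N with
  | nil =>
    rw [conjugateParts_eq_append (a := 0) (by simp) (Nat.zero_le N),
      modeVector_append_replicate_zero h0']
    simp [conjugateParts, modeVector]
  | cons a w ih =>
    rw [List.pairwise_cons] at hw
    have hlen : (conjugateParts w a).length = a := by simp [conjugateParts]
    -- All parts are at most a, so the entries beyond position a are zeros and act trivially on 1.
    rw [conjugateParts_eq_append (a := a) (by simpa using hw.1) (hN a (by simp)),
      modeVector_append_replicate_zero h0', conjugateParts_cons, modeVector_cons,
      ih hw.2 a hw.1]
    have h := op_length_modeVector h0 hop (conjugateParts w a)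
    rw [hlen] at h
    have h1 : (-1 : Fock) ^ w.sum = C ((-1) ^ w.sum) := by simp
    rw [h1, ← MvPolynomial.smul_eq_C_mul, map_smul, h, MvPolynomial.smul_eq_C_mul, ← h1,
      List.sum_cons, pow_add]
    ring

theorem YoungDiagram.countP_rowLens (lam : YoungDiagram) (j : ℕ) :
    lam.rowLens.countP (fun x => decide (j < x)) = lam.colLen j := by
  have h : ∀ i, (j < lam.rowLen i) ↔ i < lam.colLen j := fun i => by
    rw [← YoungDiagram.mem_iff_lt_rowLen, YoungDiagram.mem_iff_lt_colLen]
  have hle : lam.colLen j ≤ lam.colLen 0 := lam.colLen_anti 0 j (Nat.zero_le j)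
  rw [YoungDiagram.rowLens, List.countP_map]
  obtain ⟨k, hk⟩ := Nat.exists_eq_add_of_le hle
  rw [hk, List.range_add, List.countP_append]
  have h1 : (List.range (lam.colLen j)).countP ((fun x => decide (j < x)) ∘ lam.rowLen) =
      lam.colLen j := by
    conv_rhs => rw [← List.length_range (n := lam.colLen j)]
    rw [List.countP_eq_length]
    intro i hi
    simpa [h] using hi
  rw [h1, List.countP_eq_zero.2, add_zero]
  intro i hi
  simp only [List.mem_map, List.mem_range] at hi
  obtain ⟨l, -, rfl⟩ := hi
  simp [h]

theorem YoungDiagram.rowLens_transpose (lam : YoungDiagram) :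
    lam.transpose.rowLens = conjugateParts lam.rowLens (lam.rowLen 0) := by
  simp only [conjugateParts, YoungDiagram.countP_rowLens]
  rw [YoungDiagram.rowLens, YoungDiagram.colLen_transpose]
  exact List.map_congr_left fun i _ => YoungDiagram.rowLen_transpose lam i

theorem YoungDiagram.sum_rowLens (lam : YoungDiagram) : lam.rowLens.sum = lam.card := by
  rw [YoungDiagram.rowLens, YoungDiagram.card,
    Finset.card_eq_sum_card_fiberwise (f := Prod.fst) (t := Finset.range (lam.colLen 0))]
  · rw [← List.sum_toFinset _ List.nodup_range, List.toFinset_range]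
    refine Finset.sum_congr rfl fun i _ => ?_
    rw [YoungDiagram.rowLen_eq_card]
    rfl
  · rintro ⟨i, j⟩ hij
    have h1 : (i, j) ∈ lam := hij
    have h2 := lam.up_left_mem le_rfl (Nat.zero_le j) h1
    simpa using YoungDiagram.mem_iff_lt_colLen.1 h2

theorem YoungDiagram.le_of_mem_rowLens (lam : YoungDiagram) {x : ℕ} (hx : x ∈ lam.rowLens) :
    x ≤ lam.rowLen 0 := by
  simp only [YoungDiagram.rowLens, List.mem_map] at hx
  obtain ⟨i, -, rfl⟩ := hx
  exact lam.rowLen_anti 0 i (Nat.zero_le i)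

theorem modeVector_rowLens_eq_transpose {op op' : ℤ → Fock →ₗ[ℚ] Fock} (h0 : op 0 1 = 1)
    (h0' : op' 0 1 = 1)
    (hop : ∀ (a b : ℤ) (f : Fock), 0 < a + b → op a (op' b f) = -op' (b + 1) (op (a - 1) f))
    (lam : YoungDiagram) :
    modeVector op lam.rowLens = (-1 : Fock) ^ lam.card * modeVector op' lam.transpose.rowLens := by
  rw [YoungDiagram.rowLens_transpose, ← YoungDiagram.sum_rowLens]
  exact modeVector_eq_conjugate h0 h0' hop _ lam.rowLens_sorted.pairwise _
    fun x hx => lam.le_of_mem_rowLens hx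

theorem vectorY_eq_vectorYStar_transpose (lam : YoungDiagram) :
    vectorY lam = (-1 : Fock) ^ lam.card * vectorYStar lam.transpose := by
  rw [vectorY_eq, vectorYStar_eq]
  exact modeVector_rowLens_eq_transpose (vertexMode_zero_one 1) (twistedMode_zero_one (-1))
    (fun _ _ f h => vertexMode_twistedMode f h) lam

theorem vectorW_eq_vectorWStar_transpose (lam : YoungDiagram) :
    vectorW lam = (-1 : Fock) ^ lam.card * vectorWStar lam.transpose := by
  rw [vectorW_eq, vectorWStar_eq]
  exact modeVector_rowLens_eq_transpose (twistedMode_zero_one 1) (vertexMode_zero_one (-1))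
    (fun _ _ f h => twistedMode_vertexMode f h) lam

/-! ### Weight filtrations and triangularity -/

/-- The weight `∑ n m_n` of a partition with multiplicities `m`. -/
def partWeight : (ℕ+ →₀ ℕ) →+ ℕ := Finsupp.weight fun n : ℕ+ => (n : ℕ)

theorem partWeight_single (n : ℕ+) (k : ℕ) : partWeight (Finsupp.single n k) = k * n := by
  rw [partWeight, Finsupp.weight_single, smul_eq_mul]

theorem mul_le_partWeight (m : ℕ+ →₀ ℕ) (n : ℕ+) : m n * n ≤ partWeight m := by
  have h : m = Finsupp.single n (m n) + m.erase n := (Finsupp.single_add_erase n m).symm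
  calc m n * n = partWeight (Finsupp.single n (m n)) := (partWeight_single n (m n)).symm
    _ ≤ partWeight (Finsupp.single n (m n)) + partWeight (m.erase n) := Nat.le_add_right _ _
    _ = partWeight m := by rw [← map_add, ← h]

theorem finite_partWeight_le (N : ℕ) : {m : ℕ+ →₀ ℕ | partWeight m ≤ N}.Finite := by
  let M : ℕ+ →₀ ℕ := ∑ n ∈ Finset.range N, Finsupp.single n.succPNat N
  -- In weight at most N, every part that occurs and every multiplicity is at most N, hence m ≤ M.
  refine (Set.finite_Iic M).subset fun m hm n => ?_
  have h1 := (mul_le_partWeight m n).trans hm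
  by_cases h0 : m n = 0
  · rw [h0]; exact Nat.zero_le _
  · have hn : (n : ℕ) ≤ N := (Nat.le_mul_of_pos_left _ (Nat.pos_of_ne_zero h0)).trans h1
    have hmn : m n ≤ N := (Nat.le_mul_of_pos_right _ n.pos).trans h1
    refine hmn.trans ?_
    rw [Finsupp.finsetSum_apply]
    have hmem : n.natPred ∈ Finset.range N := by
      rw [Finset.mem_range, ← Nat.succ_le_iff, Nat.succ_eq_add_one, PNat.natPred_add_one]
      exact hn
    refine le_trans ?_ (Finset.single_le_sum (fun i _ => Nat.zero_le _) hmem)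
    rw [PNat.succPNat_natPred, Finsupp.single_eq_same]

/-- The monomial `∏ g_n ^ {m_n}` in the coefficients of `expCreation ε`: up to sign, a product of
complete or of elementary symmetric functions. -/
def genMonomial (ε : ℚ) (m : ℕ+ →₀ ℕ) : Fock := m.prod fun n k => genCoeff ε (n : ℕ) ^ k

theorem genMonomial_zero (ε : ℚ) : genMonomial ε 0 = 1 := Finsupp.prod_zero_index

theorem genMonomial_add (ε : ℚ) (m m' : ℕ+ →₀ ℕ) :
    genMonomial ε (m + m') = genMonomial ε m * genMonomial ε m' :=
  Finsupp.prod_add_index' (fun _ => pow_zero _) fun _ _ _ => pow_add _ _ _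

theorem genMonomial_single (ε : ℚ) (n : ℕ+) (k : ℕ) :
    genMonomial ε (Finsupp.single n k) = genCoeff ε (n : ℕ) ^ k :=
  Finsupp.prod_single_index (pow_zero _)

/-- The span of the monomials of weight at most `N`. -/
def weightFiltration (ε : ℚ) (N : ℤ) : Submodule ℤ Fock :=
  Submodule.span ℤ (genMonomial ε '' {m | (partWeight m : ℤ) ≤ N})

/-- The span of the monomials of weight less than `N`, and of those of weight `N` with a factor
`g_k`, `k > a`. -/
def partFiltration (ε : ℚ) (N : ℤ) (a : ℕ) : Submodule ℤ Fock :=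
  Submodule.span ℤ (genMonomial ε ''
    {m | (partWeight m : ℤ) ≤ N ∧ ((partWeight m : ℤ) = N → ∃ k : ℕ+, a < k ∧ m k ≠ 0)})

section Filtration

variable {ε : ℚ}

theorem genMonomial_mem {m : ℕ+ →₀ ℕ} {N : ℤ} (h : (partWeight m : ℤ) ≤ N) :
    genMonomial ε m ∈ weightFiltration ε N :=
  Submodule.subset_span ⟨m, h, rfl⟩

theorem weightFiltration_mono {N M : ℤ} (h : N ≤ M) :
    weightFiltration ε N ≤ weightFiltration ε M :=
  Submodule.span_mono (Set.image_mono fun _ hm => le_trans hm h)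

theorem partFiltration_le (N : ℤ) (a : ℕ) : partFiltration ε N a ≤ weightFiltration ε N :=
  Submodule.span_mono (Set.image_mono fun _ hm => hm.1)

theorem weightFiltration_le_partFiltration {N M : ℤ} (a : ℕ) (h : N < M) :
    weightFiltration ε N ≤ partFiltration ε M a :=
  Submodule.span_mono (Set.image_mono fun m hm => by
    have hm' : (partWeight m : ℤ) ≤ N := hm
    exact ⟨by omega, fun h' => by omega⟩)

theorem partFiltration_mono {N M : ℤ} (a : ℕ) (h : N ≤ M) :
    partFiltration ε N a ≤ partFiltration ε M a :=
  Submodule.span_mono (Set.image_mono fun m hm => by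
    have hm' := hm.1
    exact ⟨by omega, fun h' => hm.2 (by omega)⟩)

theorem partFiltration_anti (N : ℤ) {a b : ℕ} (h : a ≤ b) :
    partFiltration ε N b ≤ partFiltration ε N a :=
  Submodule.span_mono (Set.image_mono fun _ hm =>
    ⟨hm.1, fun h' => (hm.2 h').imp fun _ hk => ⟨h.trans_lt hk.1, hk.2⟩⟩)

theorem mul_mem_weightFiltration {N M : ℤ} {x y : Fock} (hx : x ∈ weightFiltration ε N)
    (hy : y ∈ weightFiltration ε M) : x * y ∈ weightFiltration ε (N + M) := by
  have h := Submodule.mul_mem_mul hx hy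
  rw [weightFiltration, weightFiltration, Submodule.span_mul_span] at h
  refine Submodule.span_mono ?_ h
  rintro _ ⟨_, ⟨m, hm, rfl⟩, _, ⟨m', hm', rfl⟩, rfl⟩
  refine ⟨m + m', ?_, genMonomial_add ε m m'⟩
  simp only [Set.mem_ofPred_eq] at hm hm' ⊢
  rw [map_add]
  push_cast
  omega

theorem one_mem_weightFiltration : (1 : Fock) ∈ weightFiltration ε 0 := by
  rw [← genMonomial_zero ε]
  exact genMonomial_mem (by simp)

theorem genCoeff_eq_genMonomial (k : ℕ+) :
    genCoeff ε (k : ℕ) = genMonomial ε (Finsupp.single k 1) := by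
  rw [genMonomial_single, pow_one]

theorem genCoeff_mem_weightFiltration (n : ℤ) : genCoeff ε n ∈ weightFiltration ε n := by
  rcases lt_trichotomy n 0 with h | h | h
  · rw [genCoeff_of_neg ε h]
    exact Submodule.zero_mem _
  · rw [h, genCoeff_zero]
    exact one_mem_weightFiltration
  · obtain ⟨i, rfl⟩ := Int.eq_ofNat_of_zero_le h.le
    lift i to ℕ+ using by omega
    rw [genCoeff_eq_genMonomial]
    exact genMonomial_mem (by rw [partWeight_single, one_mul])

theorem genCoeff_mul_mem_partFiltration_of_lt {a i : ℕ} (h : a < i) {N : ℤ} {x : Fock}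
    (hx : x ∈ weightFiltration ε N) : genCoeff ε i * x ∈ partFiltration ε (N + i) a := by
  lift i to ℕ+ using by omega
  rw [genCoeff_eq_genMonomial]
  induction hx using Submodule.span_induction with
  | mem x hx =>
    obtain ⟨m, hm, rfl⟩ := hx
    rw [← genMonomial_add]
    refine Submodule.subset_span ⟨_, ⟨?_, fun _ => ⟨i, h, ?_⟩⟩, rfl⟩
    · simp only [Set.mem_ofPred_eq] at hm
      rw [map_add, partWeight_single, one_mul]
      push_cast
      omega
    · rw [Finsupp.add_apply, Finsupp.single_eq_same]
      omega
  | zero => rw [mul_zero]; exact Submodule.zero_mem _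
  | add x y _ _ hx hy => rw [mul_add]; exact Submodule.add_mem _ hx hy
  | smul c x _ hx => rw [mul_smul_comm]; exact Submodule.smul_mem _ _ hx

theorem genCoeff_mul_mem_partFiltration {a i : ℕ} (hi : 0 < i) {N : ℤ} {x : Fock}
    (hx : x ∈ partFiltration ε N a) : genCoeff ε i * x ∈ partFiltration ε (N + i) a := by
  lift i to ℕ+ using hi
  rw [genCoeff_eq_genMonomial]
  induction hx using Submodule.span_induction with
  | mem x hx =>
    obtain ⟨m, hm, rfl⟩ := hx
    rw [← genMonomial_add]
    have hw : (partWeight (Finsupp.single i 1 + m) : ℤ) = partWeight m + (i : ℕ) := by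
      rw [map_add, partWeight_single, one_mul, Nat.cast_add, add_comm]
    refine Submodule.subset_span ⟨_, ⟨?_, fun h => ?_⟩, rfl⟩
    · have := hm.1
      omega
    · obtain ⟨k, hk, hk'⟩ := hm.2 (by omega)
      refine ⟨k, hk, ?_⟩
      rw [Finsupp.add_apply]
      omega
  | zero => rw [mul_zero]; exact Submodule.zero_mem _
  | add x y _ _ hx hy => rw [mul_add]; exact Submodule.add_mem _ hx hy
  | smul c x _ hx => rw [mul_smul_comm]; exact Submodule.smul_mem _ _ hx

variable (ε) in
/-- Laurent polynomials whose coefficient of `z ^ j` has weight at most `N - max |j| 1`. -/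
def lowLaurent (N : ℤ) : AddSubgroup (LaurentPolynomial Fock) where
  carrier := {L | ∀ j : ℤ, L.coeff j ∈ weightFiltration ε (N - max |j| 1)}
  zero_mem' _ := Submodule.zero_mem _
  add_mem' hL hM j := Submodule.add_mem _ (hL j) (hM j)
  neg_mem' hL j := Submodule.neg_mem _ (hL j)

theorem lowLaurent_mono {N M : ℤ} (h : N ≤ M) : lowLaurent ε N ≤ lowLaurent ε M :=
  fun _ hL j => weightFiltration_mono (by omega) (hL j)

theorem C_mul_mem_lowLaurent {N M : ℤ} {x : Fock} (hx : x ∈ weightFiltration ε N)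
    {L : LaurentPolynomial Fock} (hL : L ∈ lowLaurent ε M) :
    LaurentPolynomial.C x * L ∈ lowLaurent ε (N + M) := fun j => by
  rw [coeff_C_mul_laurent, add_sub_assoc]
  exact mul_mem_weightFiltration hx (hL j)

/-- The function max(|j|, 1) is subadditive, by the triangle inequality. -/
theorem mul_mem_lowLaurent {N M : ℤ} {L K : LaurentPolynomial Fock} (hL : L ∈ lowLaurent ε N)
    (hK : K ∈ lowLaurent ε M) : L * K ∈ lowLaurent ε (N + M) := fun j => by
  rw [AddMonoidAlgebra.coeff_mul_apply_left]
  refine Submodule.sum_mem _ fun i _ => ?_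
  refine weightFiltration_mono ?_ (mul_mem_weightFiltration (hL i) (hK (-i + j)))
  have h : |j| ≤ |i| + |-i + j| := by
    calc |j| = |i + (-i + j)| := by ring_nf
      _ ≤ _ := abs_add_le _ _
  omega

theorem shiftHom_sub_C_mul_mem {N M : ℤ} {x y : Fock} (hx : x ∈ weightFiltration ε N)
    (hy : y ∈ weightFiltration ε M)
    (hx' : shiftHom ε x - LaurentPolynomial.C x ∈ lowLaurent ε N)
    (hy' : shiftHom ε y - LaurentPolynomial.C y ∈ lowLaurent ε M) :
    shiftHom ε (x * y) - LaurentPolynomial.C (x * y) ∈ lowLaurent ε (N + M) := by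
  have h : shiftHom ε (x * y) - LaurentPolynomial.C (x * y) =
      LaurentPolynomial.C x * (shiftHom ε y - LaurentPolynomial.C y) +
      (LaurentPolynomial.C y * (shiftHom ε x - LaurentPolynomial.C x) +
      (shiftHom ε x - LaurentPolynomial.C x) * (shiftHom ε y - LaurentPolynomial.C y)) := by
    rw [map_mul, map_mul]
    ring
  rw [h]
  refine AddSubgroup.add_mem _ (C_mul_mem_lowLaurent hx hy')
    (AddSubgroup.add_mem _ ?_ (mul_mem_lowLaurent hx' hy'))
  rw [add_comm N M]
  exact C_mul_mem_lowLaurent hy hx'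

theorem C_mem_lowLaurent {N : ℤ} {x : Fock} (hx : x ∈ weightFiltration ε (N - 1)) :
    LaurentPolynomial.C x ∈ lowLaurent ε N := fun j => by
  rw [LaurentPolynomial.C_apply]
  split_ifs with h
  · subst h; simpa using hx
  · exact Submodule.zero_mem _

theorem T_mul_C_mem_lowLaurent {N j : ℤ} (hj : |j| = 1) {x : Fock}
    (hx : x ∈ weightFiltration ε (N - 1)) :
    LaurentPolynomial.T j * LaurentPolynomial.C x ∈ lowLaurent ε N := fun i => by
  rw [coeff_T_mul, LaurentPolynomial.C_apply]
  split_ifs with h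
  · rw [sub_eq_zero.1 h, hj]; simpa using hx
  · exact Submodule.zero_mem _

theorem shiftHom_genCoeff_sub_C_mem (hε : ε * ε = 1) (n : ℤ) :
    shiftHom ε (genCoeff ε n) - LaurentPolynomial.C (genCoeff ε n) ∈ lowLaurent ε n := by
  have h1 : genCoeff ε (n - 1) ∈ weightFiltration ε (n - 1) := genCoeff_mem_weightFiltration _
  have h : shiftHom ε (genCoeff ε n) - LaurentPolynomial.C (genCoeff ε n) =
      LaurentPolynomial.C (genCoeff ε (n - 2)) -
      (LaurentPolynomial.T 1 * LaurentPolynomial.C (genCoeff ε (n - 1)) +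
        LaurentPolynomial.T (-1) * LaurentPolynomial.C (genCoeff ε (n - 1))) := by
    rw [shiftHom_genCoeff hε]
    ring
  rw [h]
  exact AddSubgroup.sub_mem _
    (C_mem_lowLaurent (weightFiltration_mono (by omega) (genCoeff_mem_weightFiltration _)))
    (AddSubgroup.add_mem _ (T_mul_C_mem_lowLaurent (by simp) h1)
      (T_mul_C_mem_lowLaurent (by simp) h1))

/-- For one g_n the shift adds g_(n-2) - (z + z^(-1)) g_(n-1): each power of z costs at least its
absolute value in weight, and even the constant correction costs at least one. Both bounds survive
products, which explains the form of `lowLaurent`. -/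
theorem shiftHom_genMonomial_sub_C_mem (hε : ε * ε = 1) (m : ℕ+ →₀ ℕ) :
    shiftHom ε (genMonomial ε m) - LaurentPolynomial.C (genMonomial ε m) ∈
      lowLaurent ε (partWeight m) := by
  induction m using Finsupp.induction_linear with
  | zero => simp [genMonomial_zero]
  | add m m' hm hm' =>
    rw [genMonomial_add, map_add, Nat.cast_add]
    exact shiftHom_sub_C_mul_mem (genMonomial_mem le_rfl) (genMonomial_mem le_rfl) hm hm'
  | single n k =>
    induction k with
    | zero => simp [genMonomial_zero]
    | succ k ih =>
      rw [Finsupp.single_add, genMonomial_add, map_add, Nat.cast_add]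
      refine shiftHom_sub_C_mul_mem (genMonomial_mem le_rfl) (genMonomial_mem le_rfl) ih ?_
      rw [genMonomial_single, partWeight_single, pow_one, one_mul]
      exact shiftHom_genCoeff_sub_C_mem hε _

theorem shiftHom_sub_C_mem (hε : ε * ε = 1) {N : ℤ} {x : Fock} (hx : x ∈ weightFiltration ε N) :
    shiftHom ε x - LaurentPolynomial.C x ∈ lowLaurent ε N := by
  induction hx using Submodule.span_induction with
  | mem x hx =>
    obtain ⟨m, hm, rfl⟩ := hx
    exact lowLaurent_mono hm (shiftHom_genMonomial_sub_C_mem hε m)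
  | zero => simp
  | add x y _ _ hx hy =>
    rw [map_add, map_add, add_sub_add_comm]
    exact AddSubgroup.add_mem _ hx hy
  | smul c x _ hx =>
    rw [map_zsmul, map_zsmul, ← smul_sub]
    exact AddSubgroup.zsmul_mem _ hx c

/-- Triangularity of the vertex operators. -/
theorem vertexMode_sub_mem (hε : ε * ε = 1) {N : ℤ} (a : ℕ) {x : Fock}
    (hx : x ∈ weightFiltration ε N) :
    vertexMode ε a x - genCoeff ε a * x ∈ partFiltration ε (N + a) a := by
  have hL := shiftHom_sub_C_mem hε hx
  have h : vertexMode ε a x - genCoeff ε a * x =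
      creationMul ε a (shiftHom ε x - LaurentPolynomial.C x) := by
    rw [map_sub, creationMul_C, vertexMode_apply, mul_comm]
  rw [h]
  refine finsum_induction (· ∈ partFiltration ε (N + a) a) (Submodule.zero_mem _)
    (fun x y => Submodule.add_mem _) fun i => ?_
  rw [← genCoeff_natCast]
  have hi := hL ((a : ℤ) - i)
  -- The summand is g_i times a coefficient of weight at most N - max(|a - i|, 1). For i > a the
  -- total is at most N + a with a factor g_i beyond g_a; for i ≤ a the total is strictly below N +
  -- a.
  rcases lt_or_ge a i with hai | hai
  · refine partFiltration_mono _ ?_ (genCoeff_mul_mem_partFiltration_of_lt hai hi)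
    rw [abs_of_nonpos (by omega)]
    omega
  · refine weightFiltration_le_partFiltration _ ?_
      (mul_mem_weightFiltration (genCoeff_mem_weightFiltration i) hi)
    rw [abs_of_nonneg (by omega)]
    omega

theorem vertexMode_mem_weightFiltration (hε : ε * ε = 1) {N : ℤ} (a : ℕ) {x : Fock}
    (hx : x ∈ weightFiltration ε N) : vertexMode ε a x ∈ weightFiltration ε (N + a) := by
  rw [← sub_add_cancel (vertexMode ε a x) (genCoeff ε a * x)]
  refine Submodule.add_mem _ (partFiltration_le _ _ (vertexMode_sub_mem hε a hx)) ?_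
  rw [add_comm N]
  exact mul_mem_weightFiltration (genCoeff_mem_weightFiltration a) hx

theorem modeVector_mem_weightFiltration (hε : ε * ε = 1) (w : List ℕ) :
    modeVector (vertexMode ε) w ∈ weightFiltration ε w.sum := by
  induction w with
  | nil => exact one_mem_weightFiltration
  | cons a w ih =>
    rw [modeVector_cons, List.sum_cons, Nat.cast_add, add_comm]
    exact vertexMode_mem_weightFiltration hε a ih

theorem modeVector_cons_mem_partFiltration (hε : ε * ε = 1) {a b : ℕ} (hab : b < a) (w : List ℕ) :
    modeVector (vertexMode ε) (a :: w) ∈ partFiltration ε (a :: w).sum b := by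
  have hw := modeVector_mem_weightFiltration hε w
  rw [modeVector_cons, List.sum_cons, Nat.cast_add, add_comm]
  rw [← sub_add_cancel (vertexMode ε a _) (genCoeff ε a * modeVector (vertexMode ε) w)]
  exact Submodule.add_mem _ (partFiltration_anti _ hab.le (vertexMode_sub_mem hε a hw))
    (genCoeff_mul_mem_partFiltration_of_lt hab hw)

/-! ### The vectors span the lattice generated by the g_n -/

variable (ε) in
/-- The span of the vectors attached to the partitions of size at most `N`. -/
def modeVectorSpan (N : ℕ) : Submodule ℤ Fock :=
  Submodule.span ℤ (modeVector (vertexMode ε) ''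
    {w | w.Pairwise (· ≥ ·) ∧ (∀ x ∈ w, 0 < x) ∧ w.sum ≤ N})

theorem modeVectorSpan_mono {N M : ℕ} (h : N ≤ M) : modeVectorSpan ε N ≤ modeVectorSpan ε M :=
  Submodule.span_mono (Set.image_mono fun _ hw => ⟨hw.1, hw.2.1, hw.2.2.trans h⟩)

/-- If all parts of w are at most a, then a :: w is a partition and g_a times the vector of w is the
vector of a :: w up to the triangularity error. Otherwise the first part of w exceeds a, and the
whole product already lies in the filtration step assumed to be spanned. -/
theorem genCoeff_mul_mem_modeVectorSpan (hε : ε * ε = 1) {N a : ℕ} (ha : 0 < a)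
    (hG : partFiltration ε (N + a : ℕ) a ≤ modeVectorSpan ε (N + a)) {x : Fock}
    (hx : x ∈ modeVectorSpan ε N) : genCoeff ε a * x ∈ modeVectorSpan ε (N + a) := by
  induction hx using Submodule.span_induction with
  | mem x hx =>
    obtain ⟨w, ⟨hw, hpos, hsum⟩, rfl⟩ := hx
    have hF := modeVector_mem_weightFiltration hε w
    by_cases hle : ∀ x ∈ w, x ≤ a
    · have h1 : modeVector (vertexMode ε) (a :: w) ∈ modeVectorSpan ε (N + a) := by
        refine Submodule.subset_span ⟨a :: w, ⟨List.pairwise_cons.2 ⟨hle, hw⟩, ?_, ?_⟩, rfl⟩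
        · simpa using ⟨ha, hpos⟩
        · rw [List.sum_cons]; omega
      have h2 := hG (partFiltration_mono _ (by omega) (vertexMode_sub_mem hε a hF))
      have h3 := Submodule.sub_mem _ h1 h2
      rwa [modeVector_cons, sub_sub_cancel] at h3
    · cases w with
      | nil => simp at hle
      | cons b w =>
        have hab : a < b := by
          by_contra hcon
          refine hle fun x hx => ?_
          rcases List.mem_cons.1 hx with rfl | hx
          · exact not_lt.1 hcon
          · exact ((List.pairwise_cons.1 hw).1 x hx).trans (not_lt.1 hcon)
        refine hG (partFiltration_mono _ ?_ (genCoeff_mul_mem_partFiltration ha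
          (modeVector_cons_mem_partFiltration hε hab w)))
        omega
  | zero => rw [mul_zero]; exact Submodule.zero_mem _
  | add x y _ _ hx hy => rw [mul_add]; exact Submodule.add_mem _ hx hy
  | smul c x _ hx => rw [mul_smul_comm]; exact Submodule.smul_mem _ _ hx

/-- Downward induction on the threshold a, inside an induction on the weight. For a = N no monomial
of weight N has a factor g_k with k > N. In the step, only monomials with a factor g_(a+1) are new;
removing that factor leaves a smaller weight, already known to be spanned. -/
theorem partFiltration_le_modeVectorSpan (hε : ε * ε = 1) (N : ℕ)
    (ih : ∀ M < N, weightFiltration ε M ≤ modeVectorSpan ε M) (d : ℕ) (a : ℕ) (had : a + d = N) :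
    partFiltration ε N a ≤ modeVectorSpan ε N := by
  have hlow : ∀ m : ℕ+ →₀ ℕ, partWeight m < N → genMonomial ε m ∈ modeVectorSpan ε N :=
    fun m hm => modeVectorSpan_mono hm.le (ih _ hm (genMonomial_mem le_rfl))
  induction d generalizing a with
  | zero =>
    refine Submodule.span_le.2 ?_
    rintro _ ⟨m, ⟨hm, hm'⟩, rfl⟩
    refine hlow m (lt_of_le_of_ne (by exact_mod_cast hm) fun h => ?_)
    obtain ⟨k, hk, hmk⟩ := hm' (by exact_mod_cast h)
    have h1 := mul_le_partWeight m k
    have h2 : (k : ℕ) ≤ m k * k := Nat.le_mul_of_pos_left _ (Nat.pos_of_ne_zero hmk)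
    omega
  | succ d ihd =>
    refine Submodule.span_le.2 ?_
    rintro _ ⟨m, ⟨hm, hm'⟩, rfl⟩
    have hmle : partWeight m ≤ N := by exact_mod_cast hm
    rcases hmle.lt_or_eq with hlt | heq
    · exact hlow m hlt
    obtain ⟨k, hk, hmk⟩ := hm' (by exact_mod_cast heq)
    have hG := ihd (a + 1) (by omega)
    rcases (Nat.succ_le_iff.2 hk).lt_or_eq with hlt | hka
    · exact hG (Submodule.subset_span ⟨m, ⟨hm, fun _ => ⟨k, hlt, hmk⟩⟩, rfl⟩)
    · obtain ⟨m, rfl⟩ : ∃ m', m = Finsupp.single k 1 + m' := by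
        refine ⟨m - Finsupp.single k 1, (add_tsub_cancel_of_le ?_).symm⟩
        rw [Finsupp.single_le_iff]
        omega
      rw [map_add, partWeight_single, one_mul] at heq
      have hx := ih (partWeight m) (by have := k.pos; omega) (genMonomial_mem le_rfl)
      obtain rfl : N = partWeight m + (k : ℕ) := by omega
      rw [genMonomial_add, genMonomial_single, pow_one]
      rw [← Nat.succ_eq_add_one, hka] at hG
      exact genCoeff_mul_mem_modeVectorSpan hε k.pos hG hx

theorem weightFiltration_le_modeVectorSpan (hε : ε * ε = 1) (N : ℕ) :
    weightFiltration ε N ≤ modeVectorSpan ε N := by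
  induction N using Nat.strong_induction_on with
  | _ N ih =>
    refine Submodule.span_le.2 ?_
    rintro _ ⟨m, hm, rfl⟩
    have hm' : partWeight m ≤ N := by simpa using hm
    by_cases h0 : m = 0
    · rw [h0, genMonomial_zero]
      exact Submodule.subset_span ⟨[], ⟨List.Pairwise.nil, by simp, by simp⟩, rfl⟩
    · refine partFiltration_le_modeVectorSpan hε N ih N 0 (zero_add N)
        (Submodule.subset_span ⟨m, ⟨hm, fun _ => ?_⟩, rfl⟩)
      obtain ⟨k, hk⟩ := Finsupp.ne_iff.1 h0
      exact ⟨k, k.pos, hk⟩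

end Filtration

/-! ### The fundamental theorem of symmetric functions -/

/-- The specialization of `ℚ[p₁, p₂, …]` to symmetric polynomials in `N` variables. -/
def realizeFin (N : ℕ) : Fock →ₐ[ℚ] MvPolynomial (Fin N) ℚ :=
  aeval fun n : ℕ+ => psum (Fin N) ℚ n

theorem coeff_embDomain_powerSum {σ : Type*} (e : σ ↪ ℕ) (n : ℕ+) (m : σ →₀ ℕ) [Decidable (∃ i, m = Finsupp.single i (n : ℕ))] :
    MvPowerSeries.coeff (m.embDomain e) (powerSum n) =
      if ∃ i, m = Finsupp.single i (n : ℕ) then 1 else 0 := by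
  classical
  change (if ∃ i : ℕ, m.embDomain e = Finsupp.single i (n : ℕ) then (1 : ℚ) else 0) = _
  refine if_congr ⟨?_, ?_⟩ rfl rfl
  · rintro ⟨i, hi⟩
    obtain ⟨j, hj, -⟩ := Finsupp.single_of_embDomain_single m e i n n.ne_zero hi
    exact ⟨j, hj⟩
  · rintro ⟨j, rfl⟩
    exact ⟨e j, Finsupp.embDomain_single e j _⟩

theorem coeff_psum {N : ℕ} (n : ℕ+) (m : Fin N →₀ ℕ) [Decidable (∃ i, m = Finsupp.single i (n : ℕ))] :
    coeff m (psum (Fin N) ℚ n) = if ∃ i, m = Finsupp.single i (n : ℕ) then 1 else 0 := by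
  classical
  rw [psum, coeff_sum]
  simp only [coeff_X_pow]
  split_ifs with h
  · obtain ⟨i, rfl⟩ := h
    rw [Finset.sum_eq_single i, if_pos rfl]
    · intro j _ hj
      rw [if_neg]
      intro h
      exact hj ((Finsupp.single_left_inj n.ne_zero).1 h)
    · simp
  · refine Finset.sum_eq_zero fun i _ => if_neg fun hi => h ⟨i, hi.symm⟩

/-- Setting x_i = 0 for i ≥ N is an algebra homomorphism taking each p_n to the power sum in N
variables, so coefficients can be read off in finitely many variables. -/
theorem coeff_embDomain_realize {N : ℕ} (f : Fock) (m : Fin N →₀ ℕ) :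
    MvPowerSeries.coeff (m.embDomain Fin.valEmbedding) (realize f) = coeff m (realizeFin N f) := by
  classical
  have h : (MvPowerSeries.killCompl (Fin.valEmbedding (n := N))).comp realize =
      (coeToMvPowerSeries.algHom ℚ).comp (realizeFin N) := by
    refine MvPolynomial.algHom_ext fun n => ?_
    ext m
    rw [AlgHom.comp_apply, AlgHom.comp_apply, realize, realizeFin, aeval_X, aeval_X,
      MvPowerSeries.coeff_killCompl, coeff_embDomain_powerSum, coeToMvPowerSeries.algHom_apply,
      Algebra.algebraMap_self, MvPowerSeries.map_id, RingHom.id_apply, coeff_coe, coeff_psum]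
  have h1 := congrArg (MvPowerSeries.coeff m) (AlgHom.congr_fun h f)
  rw [AlgHom.comp_apply, AlgHom.comp_apply, MvPowerSeries.coeff_killCompl,
    coeToMvPowerSeries.algHom_apply, Algebra.algebraMap_self, MvPowerSeries.map_id,
    RingHom.id_apply, coeff_coe] at h1
  exact h1

/-- Renaming variables by a permutation is an algebra homomorphism that fixes every p_n. -/
theorem coeff_mapDomain_realize (f : Fock) (σ : Equiv.Perm ℕ) (m : ℕ →₀ ℕ) :
    MvPowerSeries.coeff (m.mapDomain σ) (realize f) = MvPowerSeries.coeff m (realize f) := by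
  classical
  have h : (MvPowerSeries.killCompl σ.toEmbedding).comp realize = realize := by
    refine MvPolynomial.algHom_ext fun n => ?_
    ext m
    rw [AlgHom.comp_apply, realize, aeval_X, MvPowerSeries.coeff_killCompl,
      coeff_embDomain_powerSum]
    rfl
  have h1 := congrArg (MvPowerSeries.coeff m) (AlgHom.congr_fun h f)
  rw [AlgHom.comp_apply, MvPowerSeries.coeff_killCompl, Finsupp.embDomain_eq_mapDomain] at h1
  exact h1

theorem exists_embDomain_eq (m : ℕ →₀ ℕ) :
    ∃ (N : ℕ) (m' : Fin N →₀ ℕ), m = m'.embDomain Fin.valEmbedding := by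
  obtain ⟨N, hN⟩ := m.support.exists_nat_subset_range
  refine ⟨N, m.comapDomain Fin.valEmbedding Fin.valEmbedding.injective.injOn,
    (Finsupp.embDomain_comapDomain fun i hi => ?_).symm⟩
  exact ⟨⟨i, Finset.mem_range.1 (hN hi)⟩, rfl⟩

theorem exists_mapDomain_eq_embDomain {d : ℕ} (m : ℕ →₀ ℕ) (hm : m.degree ≤ d) :
    ∃ (σ : Equiv.Perm ℕ) (m' : Fin d →₀ ℕ), m.mapDomain σ = m'.embDomain Fin.valEmbedding := by
  classical
  have hcard : m.support.card ≤ d := by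
    refine le_trans ?_ hm
    rw [Finsupp.degree_apply, Finset.card_eq_sum_ones]
    exact Finset.sum_le_sum fun i hi => Nat.one_le_iff_ne_zero.2 (Finsupp.mem_support_iff.1 hi)
  let x : Fin m.support.card ↪ ℕ := (m.support.orderEmbOfFin rfl).toEmbedding
  -- The permutations of ℕ are k-transitive for every k, so the at most d variables of m can be
  -- moved to the initial ones.
  obtain ⟨g, hg⟩ := (Equiv.Perm.isMultiplyPretransitive ℕ m.support.card).exists_smul_eq x
    (Fin.valEmbedding (n := m.support.card))
  have hg' : ∀ i, g (x i) = i := fun i => congrArg (fun e => e i) hg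
  refine ⟨g, (m.mapDomain g).comapDomain Fin.valEmbedding Fin.valEmbedding.injective.injOn,
    (Finsupp.embDomain_comapDomain fun i hi => ?_).symm⟩
  obtain ⟨j, hj, rfl⟩ := Finset.mem_image.1 (Finsupp.mapDomain_support hi)
  have hj' : j ∈ Set.range (m.support.orderEmbOfFin rfl) := by
    rw [Finset.range_orderEmbOfFin]
    exact hj
  obtain ⟨k, rfl⟩ := hj'
  have hk : g (m.support.orderEmbOfFin rfl k) = k := hg' k
  rw [hk]
  exact ⟨⟨k, k.2.trans_le hcard⟩, rfl⟩

/-- Newton's identities say that ∑ (-1)^n e_n z^n satisfies the differential equation that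
characterizes the creation series for ε = -1. -/
theorem realizeFin_genCoeff_neg_one (N n : ℕ) :
    realizeFin N (genCoeff (-1) n) = (-1) ^ n * esymm (Fin N) ℚ n := by
  have hB : PowerSeries.map (realizeFin N : Fock →+* MvPolynomial (Fin N) ℚ) (expCreation (-1)) =
      PowerSeries.mk fun n => (-1) ^ n * esymm (Fin N) ℚ n := by
    refine PowerSeries.eq_of_derivative_eq_mul (derivative_map_expCreation _ _) ?_ ?_
    · ext1 n
      rw [PowerSeries.coeff_derivative, PowerSeries.coeff_mk, PowerSeries.coeff_mul]
      have h := mul_esymm_eq_sum (Fin N) ℚ (n + 1)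
      rw [Finset.sum_filter, Finset.Nat.sum_antidiagonal_succ', if_neg (lt_irrefl _), zero_add] at h
      have h2 : ∑ x ∈ Finset.HasAntidiagonal.antidiagonal n,
          (if x.1 < n + 1 then (-1) ^ x.1 * esymm (Fin N) ℚ x.1 * psum (Fin N) ℚ (x.2 + 1) else 0) =
          ∑ x ∈ Finset.HasAntidiagonal.antidiagonal n,
            (-1) ^ x.1 * esymm (Fin N) ℚ x.1 * psum (Fin N) ℚ (x.2 + 1) :=
        Finset.sum_congr rfl fun x hx => if_pos (by
          have := Finset.HasAntidiagonal.mem_antidiagonal.1 hx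
          omega)
      rw [h2] at h
      have h3 : ∀ x ∈ Finset.HasAntidiagonal.antidiagonal n,
          PowerSeries.coeff x.1 (PowerSeries.mk fun n => (-1) ^ n * esymm (Fin N) ℚ n) *
            PowerSeries.coeff x.2 ((-1 : ℚ) • PowerSeries.map
              (realizeFin N : Fock →+* MvPolynomial (Fin N) ℚ) powerSumSeries) =
          -((-1) ^ x.1 * esymm (Fin N) ℚ x.1 * psum (Fin N) ℚ (x.2 + 1)) := by
        intro x _
        have h4 : realizeFin N (X x.2.succPNat) = psum (Fin N) ℚ (x.2 + 1) := by
          rw [realizeFin, aeval_X]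
          rfl
        rw [neg_one_smul, map_neg, PowerSeries.coeff_map, PowerSeries.coeff_mk, powerSumSeries,
          PowerSeries.coeff_mk, RingHom.coe_coe, h4, mul_neg]
      rw [Finset.sum_congr rfl h3, Finset.sum_neg_distrib]
      push_cast at h
      have h5 : ((-1 : MvPolynomial (Fin N) ℚ) ^ (n + 1)) * (-1) ^ (n + 1) = 1 := by
        rw [← mul_pow]; simp
      have h6 : ((-1 : MvPolynomial (Fin N) ℚ) ^ (n + 1)) * (-1) ^ (n + 1 + 1) = -1 := by
        rw [pow_succ _ (n + 1), ← mul_assoc, h5, one_mul]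
      linear_combination (-1) ^ (n + 1) * h + (∑ x ∈ Finset.HasAntidiagonal.antidiagonal n,
            (-1) ^ x.1 * esymm (Fin N) ℚ x.1 * psum (Fin N) ℚ (x.2 + 1)) * h6
    · simp [coeff_zero_expCreation]
  have h := congrArg (PowerSeries.coeff n) hB
  rw [PowerSeries.coeff_map, PowerSeries.coeff_mk, ← genCoeff_natCast] at h
  exact h

/-- The elementary symmetric function `e_n`. -/
def elementary (n : ℕ) : Fock := (-1) ^ n * genCoeff (-1) n

theorem realizeFin_elementary (N n : ℕ) : realizeFin N (elementary n) = esymm (Fin N) ℚ n := by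
  rw [elementary, map_mul, realizeFin_genCoeff_neg_one, map_pow, map_neg, map_one, ← mul_assoc,
    ← mul_pow, neg_one_mul, neg_neg, one_pow, one_mul]

/-- The embedding of the polynomial ring in the elementary symmetric functions. -/
def elementaryHom : MvPolynomial ℕ+ ℤ →+* Fock := eval₂Hom (Int.castRingHom Fock) fun n : ℕ+ => elementary n

theorem realizeFin_elementaryHom (N : ℕ) (P : MvPolynomial ℕ+ ℤ) :
    realizeFin N (elementaryHom P) =
      map (Int.castRingHom ℚ) (aeval (fun n : ℕ+ => esymm (Fin N) ℤ n) P) := by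
  have h : (realizeFin N : Fock →+* MvPolynomial (Fin N) ℚ).comp elementaryHom =
      (map (Int.castRingHom ℚ)).comp
        (aeval (fun n : ℕ+ => esymm (Fin N) ℤ n) : MvPolynomial ℕ+ ℤ →ₐ[ℤ] _).toRingHom := by
    refine MvPolynomial.ringHom_ext (fun c => ?_) fun n => ?_
    · simp
    · simp [elementaryHom, realizeFin_elementary, map_esymm]
  exact RingHom.congr_fun h P

theorem isHomogeneous_esymm (N n : ℕ) : (esymm (Fin N) ℚ n).IsHomogeneous n := by
  refine IsHomogeneous.sum _ _ _ fun t ht => ?_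
  have h := IsHomogeneous.prod t (fun i => (X i : MvPolynomial (Fin N) ℚ)) (fun _ => 1)
    fun i _ => isHomogeneous_X ℚ i
  rwa [← Finset.card_eq_sum_ones, (Finset.mem_powersetCard.1 ht).2] at h

theorem coeff_realize_eq_zero_of_degree_ne {f : Fock} {n : ℕ}
    (h : ∀ N, (realizeFin N f).IsHomogeneous n) {m : ℕ →₀ ℕ} (hm : m.degree ≠ n) :
    MvPowerSeries.coeff m (realize f) = 0 := by
  obtain ⟨N, m', rfl⟩ := exists_embDomain_eq m
  rw [coeff_embDomain_realize]
  rw [Finsupp.embDomain_eq_mapDomain, Finsupp.degree_mapDomain] at hm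
  exact (h N).coeff_eq_zero hm

theorem isHomogeneous_realizeFin_elementaryHom (N : ℕ) (m : ℕ+ →₀ ℕ) :
    (realizeFin N (elementaryHom (monomial m 1))).IsHomogeneous (partWeight m) := by
  induction m using Finsupp.induction_linear with
  | zero => simpa using isHomogeneous_one (Fin N) ℚ
  | add m m' hm hm' =>
    rw [← mul_one (1 : ℤ), ← monomial_mul, map_mul, map_mul, map_add]
    exact hm.mul hm'
  | single n k =>
    rw [← X_pow_eq_monomial, map_pow, map_pow, partWeight_single, mul_comm]
    refine IsHomogeneous.pow ?_ k
    rw [elementaryHom, coe_eval₂Hom, eval₂_X, realizeFin_elementary]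
    exact isHomogeneous_esymm N n

theorem realize_elementaryHom_eq_sum (P : MvPolynomial ℕ+ ℤ) :
    realize (elementaryHom P) =
      ∑ m ∈ P.support, P.coeff m • realize (elementaryHom (monomial m 1)) := by
  conv_lhs => rw [P.as_sum]
  rw [map_sum, map_sum]
  refine Finset.sum_congr rfl fun m _ => ?_
  rw [← map_zsmul, ← map_zsmul, smul_monomial, smul_eq_mul, mul_one]

theorem realize_elementaryHom_mem (P : MvPolynomial ℕ+ ℤ) :
    realize (elementaryHom P) ∈ integralSymmetricFunctions := by
  rw [realize_elementaryHom_eq_sum]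
  refine Submodule.sum_mem _ fun m _ => Submodule.smul_mem _ _ ⟨?_, ⟨partWeight m, ?_⟩, ?_⟩
  · exact fun σ μ => coeff_mapDomain_realize _ σ μ
  · intro μ hμ
    by_contra hcon
    exact hμ (coeff_realize_eq_zero_of_degree_ne
      (fun N => isHomogeneous_realizeFin_elementaryHom N m) (by omega))
  · intro μ
    obtain ⟨N, μ', rfl⟩ := exists_embDomain_eq μ
    rw [coeff_embDomain_realize, realizeFin_elementaryHom, coeff_map]
    exact ⟨_, rfl⟩

theorem realize_elementaryHom_injective :
    Function.Injective fun P : MvPolynomial ℕ+ ℤ => realize (elementaryHom P) := by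
  have key : ∀ P : MvPolynomial ℕ+ ℤ, realize (elementaryHom P) = 0 → P = 0 := by
    intro P hP
    -- N is taken so large that P involves only X_1, …, X_N; their images e_1, …, e_N are
    -- algebraically independent in N variables.
    obtain ⟨N, hN⟩ := (P.vars.image PNat.natPred).exists_nat_subset_range
    let j : Fin N → ℕ+ := fun i => (i : ℕ).succPNat
    have hj : Function.Injective j := fun a b h => Fin.ext (Nat.succPNat_injective h)
    obtain ⟨Q, rfl⟩ := exists_rename_eq_of_vars_subset_range P j hj fun n hn => by
      have := Finset.mem_range.1 (hN (Finset.mem_image_of_mem _ hn))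
      exact ⟨⟨n.natPred, this⟩, PNat.succPNat_natPred n⟩
    have h1 : realizeFin N (elementaryHom (rename j Q)) = 0 := by
      ext m
      rw [← coeff_embDomain_realize, hP]
      simp
    rw [realizeFin_elementaryHom, aeval_rename] at h1
    have h2 := map_injective (σ := Fin N) (Int.castRingHom ℚ) Int.cast_injective
      (h1.trans (map_zero _).symm)
    have h3 : esymmAlgHom (Fin N) ℤ N Q = 0 := by
      apply Subtype.ext
      rw [esymmAlgHom_apply]
      exact h2
    rw [(esymmAlgHom_fin_bijective ℤ N).1 (h3.trans (map_zero _).symm), map_zero]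
  intro P Q h
  refine sub_eq_zero.1 (key _ ?_)
  rw [map_sub, map_sub, sub_eq_zero]
  exact h

/-- A symmetric function of degree at most d is determined by its restriction to d variables, since
a monomial of degree at most d involves at most d variables and can be permuted into them. The
restriction is an integral polynomial in e_1, …, e_d by the theorem in finitely many variables. -/
theorem exists_realize_elementaryHom_eq {f : MvPowerSeries ℕ ℚ}
    (hf : f ∈ integralSymmetricFunctions) : ∃ P, realize (elementaryHom P) = f := by
  classical
  obtain ⟨hsymm, ⟨d, hd⟩, hint⟩ := hf
  choose c hc using hint
  let ι : Fin d ↪ ℕ := Fin.valEmbedding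
  let S : Finset (Fin d →₀ ℕ) := (Finsupp.finite_of_degree_lt (σ := Fin d) (d + 1)).toFinset
  let q : MvPolynomial (Fin d) ℤ := ∑ m ∈ S, monomial m (c (m.embDomain ι))
  have hq : ∀ m, coeff m q = c (m.embDomain ι) := by
    intro m
    simp only [q, coeff_sum, coeff_monomial]
    rw [Finset.sum_ite_eq' S m]
    split_ifs with hm
    · rfl
    · have h0 : MvPowerSeries.coeff (m.embDomain ι) f = 0 := by
        by_contra hne
        have h1 := hd _ hne
        rw [Finsupp.embDomain_eq_mapDomain, Finsupp.degree_mapDomain] at h1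
        exact hm ((Set.Finite.mem_toFinset _).2 (Nat.lt_succ_of_le h1))
      have h2 := hc (m.embDomain ι)
      rw [h0] at h2
      exact_mod_cast h2
  have hqsymm : q.IsSymmetric := by
    intro e
    ext m
    obtain ⟨m, rfl⟩ : ∃ m', m = Finsupp.mapDomain e m' :=
      ⟨Finsupp.mapDomain e.symm m, by rw [← Finsupp.mapDomain_comp]; simp⟩
    rw [coeff_rename_mapDomain e e.injective, hq, hq]
    have h1 : (Finsupp.mapDomain e m).embDomain ι =
        Finsupp.mapDomain (e.viaFintypeEmbedding ι) (m.embDomain ι) := by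
      rw [Finsupp.embDomain_eq_mapDomain, Finsupp.embDomain_eq_mapDomain, ← Finsupp.mapDomain_comp,
        ← Finsupp.mapDomain_comp]
      congr 1
      funext i
      exact (e.viaFintypeEmbedding_apply_image ι i).symm
    have h2 := hsymm (e.viaFintypeEmbedding ι) (m.embDomain ι)
    rw [hc, hc, ← h1] at h2
    exact_mod_cast h2.symm
  obtain ⟨Q, hQ⟩ := (esymmAlgHom_fin_bijective ℤ d).2 ⟨q, hqsymm⟩
  have hQ' := congrArg Subtype.val hQ
  rw [esymmAlgHom_apply] at hQ'
  let P : MvPolynomial ℕ+ ℤ := rename (fun i : Fin d => (i : ℕ).succPNat) Q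
  have hP : realizeFin d (elementaryHom P) = map (Int.castRingHom ℚ) q := by
    rw [realizeFin_elementaryHom, aeval_rename]
    exact congrArg _ hQ'
  -- In infinitely many variables, monomials in the e_n of weight above d would contribute only in
  -- degrees above d, where f vanishes; discarding them changes nothing in degrees at most d.
  let P' : MvPolynomial ℕ+ ℤ :=
    ∑ m ∈ P.support with partWeight m ≤ d, monomial m (P.coeff m)
  have hzero : ∀ (m : ℕ+ →₀ ℕ) (μ : ℕ →₀ ℕ), μ.degree ≠ partWeight m →
      MvPowerSeries.coeff μ (realize (elementaryHom (monomial m 1))) = 0 := fun m μ h =>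
    coeff_realize_eq_zero_of_degree_ne (fun N => isHomogeneous_realizeFin_elementaryHom N m) h
  have hP'sum : realize (elementaryHom P') = ∑ m ∈ P.support with partWeight m ≤ d,
      P.coeff m • realize (elementaryHom (monomial m 1)) := by
    rw [map_sum, map_sum]
    refine Finset.sum_congr rfl fun m _ => ?_
    rw [← map_zsmul, ← map_zsmul, smul_monomial, smul_eq_mul, mul_one]
  refine ⟨P', ?_⟩
  ext μ
  by_cases hμ : μ.degree ≤ d
  · have h1 : MvPowerSeries.coeff μ (realize (elementaryHom P')) =
        MvPowerSeries.coeff μ (realize (elementaryHom P)) := by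
      rw [hP'sum, realize_elementaryHom_eq_sum P, map_sum, map_sum]
      refine Finset.sum_subset (Finset.filter_subset _ _) fun m hm hm' => ?_
      rw [map_zsmul, hzero, smul_zero]
      intro h
      exact hm' (Finset.mem_filter.2 ⟨hm, h ▸ hμ⟩)
    obtain ⟨σ, μ', hμ'⟩ := exists_mapDomain_eq_embDomain μ hμ
    rw [h1, ← coeff_mapDomain_realize _ σ, ← hsymm σ, hμ', coeff_embDomain_realize, hP, coeff_map,
      hq, hc]
    rfl
  · have h1 : MvPowerSeries.coeff μ f = 0 := by
      by_contra hne
      exact hμ (hd μ hne)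
    rw [h1, hP'sum, map_sum]
    refine Finset.sum_eq_zero fun m hm => ?_
    have := (Finset.mem_filter.1 hm).2
    rw [map_zsmul, hzero, smul_zero]
    omega

/-! ### Complete and elementary generators of the lattice -/

/-- The homomorphism from `ℤ[X₁, X₂, …]` sending `X_n` to the coefficient of `z ^ n` in
`expCreation ε`. -/
def genHom (ε : ℚ) : MvPolynomial ℕ+ ℤ →+* Fock :=
  eval₂Hom (Int.castRingHom Fock) fun n : ℕ+ => genCoeff ε (n : ℕ)

theorem genHom_X (ε : ℚ) (n : ℕ+) : genHom ε (X n) = genCoeff ε (n : ℕ) := eval₂Hom_X' _ _ _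

theorem genHom_monomial (ε : ℚ) (m : ℕ+ →₀ ℕ) : genHom ε (monomial m 1) = genMonomial ε m := by
  rw [genHom, eval₂Hom_monomial, map_one, one_mul]
  rfl

/-- The automorphism `X_n ↦ (-1) ^ n X_n`. -/
def degreeSignHom : MvPolynomial ℕ+ ℤ →ₐ[ℤ] MvPolynomial ℕ+ ℤ := aeval fun n : ℕ+ => (-1) ^ (n : ℕ) * X n

theorem degreeSignHom_involutive : Function.Involutive degreeSignHom := by
  have h : degreeSignHom.comp degreeSignHom = AlgHom.id ℤ _ := by
    refine MvPolynomial.algHom_ext fun n => ?_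
    simp only [degreeSignHom, AlgHom.comp_apply, aeval_X, map_mul, map_pow, map_neg, map_one,
      AlgHom.id_apply]
    rw [← mul_assoc, ← mul_pow, neg_one_mul, neg_neg, one_pow, one_mul]
  exact fun P => AlgHom.congr_fun h P

theorem genHom_neg_one_eq (P : MvPolynomial ℕ+ ℤ) :
    genHom (-1) P = elementaryHom (degreeSignHom P) := by
  have h : genHom (-1) = elementaryHom.comp (degreeSignHom : MvPolynomial ℕ+ ℤ →+* _) := by
    refine MvPolynomial.ringHom_ext (fun c => by simp) fun n => ?_
    rw [genHom_X, RingHom.comp_apply, RingHom.coe_coe, degreeSignHom, aeval_X, map_mul, map_pow, map_neg,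
      map_one, elementaryHom, coe_eval₂Hom, eval₂_X, elementary, ← mul_assoc, ← mul_pow,
      neg_one_mul, neg_neg, one_pow, one_mul]
  exact RingHom.congr_fun h P

/-- `1 + ∑ X_n t ^ n`. -/
def genericSeries : PowerSeries (MvPolynomial ℕ+ ℤ) :=
  PowerSeries.mk fun n => if h : 0 < n then X ⟨n, h⟩ else 1

theorem coeff_genericSeries (n : ℕ+) : PowerSeries.coeff (n : ℕ) genericSeries = X n := by
  rw [genericSeries, PowerSeries.coeff_mk, dif_pos n.pos]
  rfl

theorem coeff_zero_genericSeries : PowerSeries.coeff 0 genericSeries = 1 := by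
  rw [genericSeries, PowerSeries.coeff_mk, dif_neg (lt_irrefl 0)]

/-- The inverse of `1 + ∑ X_n t ^ n`. -/
def genericInverse : PowerSeries (MvPolynomial ℕ+ ℤ) := PowerSeries.invOfUnit genericSeries 1

theorem genericSeries_mul_genericInverse : genericSeries * genericInverse = 1 :=
  PowerSeries.mul_invOfUnit _ _ (by
    rw [← PowerSeries.coeff_zero_eq_constantCoeff_apply, coeff_zero_genericSeries, Units.val_one])

theorem coeff_zero_genericInverse : PowerSeries.coeff 0 genericInverse = 1 := by
  have h := congrArg (PowerSeries.coeff 0) genericSeries_mul_genericInverse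
  rw [PowerSeries.coeff_mul] at h
  simpa [coeff_zero_genericSeries] using h

/-- The involution exchanging complete and (signed) elementary symmetric functions. -/
def inverseHom : MvPolynomial ℕ+ ℤ →ₐ[ℤ] MvPolynomial ℕ+ ℤ :=
  aeval fun n : ℕ+ => PowerSeries.coeff (n : ℕ) genericInverse

theorem map_genericSeries {R : Type*} [CommRing R] (f : MvPolynomial ℕ+ ℤ →+* R)
    {F : PowerSeries R} (h0 : PowerSeries.coeff 0 F = 1)
    (hF : ∀ n : ℕ+, f (X n) = PowerSeries.coeff (n : ℕ) F) :
    PowerSeries.map f genericSeries = F := by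
  ext1 n
  rw [PowerSeries.coeff_map]
  rcases Nat.eq_zero_or_pos n with rfl | hn
  · rw [coeff_zero_genericSeries, map_one, h0]
  · lift n to ℕ+ using hn
    rw [coeff_genericSeries, hF]

theorem map_genericInverse {R : Type*} [CommRing R] (f : MvPolynomial ℕ+ ℤ →+* R)
    {F G : PowerSeries R} (h0 : PowerSeries.coeff 0 F = 1)
    (hF : ∀ n : ℕ+, f (X n) = PowerSeries.coeff (n : ℕ) F) (hG : G * F = 1) :
    PowerSeries.map f genericInverse = G := by
  have h := congrArg (PowerSeries.map f) genericSeries_mul_genericInverse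
  rw [map_mul, map_genericSeries f h0 hF, map_one] at h
  rw [← one_mul (PowerSeries.map f _), ← hG, mul_assoc, h, mul_one]

theorem inverseHom_X (n : ℕ+) : inverseHom (X n) = PowerSeries.coeff (n : ℕ) genericInverse :=
  aeval_X _ _

/-- The endomorphism carries the generic series to its inverse, hence the inverse back to the
generic series. -/
theorem inverseHom_involutive : Function.Involutive inverseHom := by
  have h1 := map_genericInverse (inverseHom : MvPolynomial ℕ+ ℤ →+* _) coeff_zero_genericInverse
    inverseHom_X genericSeries_mul_genericInverse
  have h : inverseHom.comp inverseHom = AlgHom.id ℤ _ := by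
    refine MvPolynomial.algHom_ext fun n => ?_
    have h2 := congrArg (PowerSeries.coeff (n : ℕ)) h1
    rw [PowerSeries.coeff_map, coeff_genericSeries] at h2
    rw [AlgHom.comp_apply, inverseHom_X]
    exact h2
  exact fun P => AlgHom.congr_fun h P

/-- The series for ε = 1 and ε = -1 are mutually inverse, so their coefficients are exchanged by the
universal inversion formula. -/
theorem genHom_one_eq (P : MvPolynomial ℕ+ ℤ) : genHom 1 P = genHom (-1) (inverseHom P) := by
  have h1 := map_genericInverse (genHom (-1)) (coeff_zero_expCreation (-1))
    (fun n => by rw [genHom_X, genCoeff_natCast]) (expCreation_mul_expCreation_neg 1)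
  have h : genHom 1 = (genHom (-1)).comp (inverseHom : MvPolynomial ℕ+ ℤ →+* _) := by
    refine MvPolynomial.ringHom_ext (fun c => by simp) fun n => ?_
    rw [genHom_X, RingHom.comp_apply, RingHom.coe_coe, inverseHom_X, ← PowerSeries.coeff_map, h1,
      genCoeff_natCast]
  exact RingHom.congr_fun h P

/-- The realization of an integral polynomial in the coefficients of `expCreation ε`. -/
def realizeGen (ε : ℚ) : MvPolynomial ℕ+ ℤ →ₗ[ℤ] MvPowerSeries ℕ ℚ :=
  ((realize : Fock →+* MvPowerSeries ℕ ℚ).comp (genHom ε)).toAddMonoidHom.toIntLinearMap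

theorem realizeGen_apply (ε : ℚ) (P : MvPolynomial ℕ+ ℤ) :
    realizeGen ε P = realize (genHom ε P) := rfl

/-- The fundamental theorem of symmetric functions. -/
theorem exists_bijective_realizeGen {ε : ℚ} (hε : ε = 1 ∨ ε = -1) :
    ∃ s : MvPolynomial ℕ+ ℤ → MvPolynomial ℕ+ ℤ, Function.Bijective s ∧
      ∀ P, realizeGen ε P = realize (elementaryHom (s P)) := by
  rcases hε with rfl | rfl
  · exact ⟨degreeSignHom ∘ inverseHom, degreeSignHom_involutive.bijective.comp inverseHom_involutive.bijective,
      fun P => by rw [realizeGen_apply, genHom_one_eq, genHom_neg_one_eq]; rfl⟩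
  · exact ⟨degreeSignHom, degreeSignHom_involutive.bijective,
      fun P => by rw [realizeGen_apply, genHom_neg_one_eq]⟩

theorem realizeGen_injective {ε : ℚ} (hε : ε = 1 ∨ ε = -1) :
    Function.Injective (realizeGen ε) := by
  obtain ⟨s, hs, h⟩ := exists_bijective_realizeGen hε
  intro P Q hPQ
  rw [h, h] at hPQ
  exact hs.1 (realize_elementaryHom_injective hPQ)

theorem range_realizeGen {ε : ℚ} (hε : ε = 1 ∨ ε = -1) :
    LinearMap.range (realizeGen ε) = integralSymmetricFunctions := by
  obtain ⟨s, hs, h⟩ := exists_bijective_realizeGen hε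
  ext f
  constructor
  · rintro ⟨P, rfl⟩
    rw [h]
    exact realize_elementaryHom_mem _
  · intro hf
    obtain ⟨P, rfl⟩ := exists_realize_elementaryHom_eq hf
    obtain ⟨Q, rfl⟩ := hs.2 P
    exact ⟨Q, h Q⟩

theorem linearIndependent_realize_genMonomial {ε : ℚ} (hε : ε = 1 ∨ ε = -1) :
    LinearIndependent ℤ fun m => realize (genMonomial ε m) := by
  have h : (fun m => realize (genMonomial ε m)) = realizeGen ε ∘ basisMonomials ℕ+ ℤ := by
    funext m
    rw [Function.comp_apply, coe_basisMonomials, realizeGen_apply, genHom_monomial]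
  rw [h]
  exact (basisMonomials ℕ+ ℤ).linearIndependent.map' (realizeGen ε)
    (LinearMap.ker_eq_bot.2 (realizeGen_injective hε))

theorem span_realize_genMonomial {ε : ℚ} (hε : ε = 1 ∨ ε = -1) :
    Submodule.span ℤ (Set.range fun m => realize (genMonomial ε m)) =
      integralSymmetricFunctions := by
  rw [← range_realizeGen hε, LinearMap.range_eq_map, ← (basisMonomials ℕ+ ℤ).span_eq,
    Submodule.map_span, ← Set.range_comp]
  congr 2
  funext m
  rw [Function.comp_apply, coe_basisMonomials, realizeGen_apply, genHom_monomial]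

/-- `realize`, as a `ℤ`-linear map. -/
def realizeInt : Fock →ₗ[ℤ] MvPowerSeries ℕ ℚ := realize.toLinearMap.restrictScalars ℤ

theorem realizeInt_apply (f : Fock) : realizeInt f = realize f := rfl

theorem linearIndependent_genMonomial {ε : ℚ} (hε : ε = 1 ∨ ε = -1) :
    LinearIndependent ℤ (genMonomial ε) :=
  LinearIndependent.of_comp realizeInt (linearIndependent_realize_genMonomial hε)

/-! ### Linear independence and the four bases -/

/-- The multiplicities of the parts of a partition. -/
def multiplicities (w : List ℕ) : ℕ+ →₀ ℕ := (w.map fun r => Finsupp.single r.toPNat' 1).sum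

theorem multiplicities_apply {w : List ℕ} (hw : ∀ x ∈ w, 0 < x) (n : ℕ+) :
    multiplicities w n = w.count (n : ℕ) := by
  induction w with
  | nil => rfl
  | cons a w ih =>
    have ha : 0 < a := hw a (by simp)
    have h := ih fun x hx => hw x (by simp [hx])
    rw [multiplicities] at h ⊢
    rw [List.map_cons, List.sum_cons, Finsupp.add_apply, h, List.count_cons, add_comm,
      Finsupp.single_apply]
    congr 1
    refine if_congr ?_ rfl rfl
    rw [beq_iff_eq, ← PNat.coe_inj, Nat.toPNat'_coe, if_pos ha]

theorem partWeight_multiplicities {w : List ℕ} (hw : ∀ x ∈ w, 0 < x) :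
    partWeight (multiplicities w) = w.sum := by
  induction w with
  | nil => simp [multiplicities]
  | cons a w ih =>
    have ha : 0 < a := hw a (by simp)
    have h := ih fun x hx => hw x (by simp [hx])
    rw [multiplicities] at h ⊢
    rw [List.map_cons, List.sum_cons, map_add, h, partWeight_single, one_mul, Nat.toPNat'_coe,
      if_pos ha, List.sum_cons]

theorem YoungDiagram.rowLens_injective : Function.Injective YoungDiagram.rowLens :=
  fun _ _ h => YoungDiagram.equivListRowLens.injective (Subtype.ext h)

theorem multiplicities_rowLens_injective :
    Function.Injective fun lam : YoungDiagram => multiplicities lam.rowLens := by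
  intro lam mu h
  refine YoungDiagram.rowLens_injective ?_
  have hperm : lam.rowLens.Perm mu.rowLens := by
    rw [List.perm_iff_count]
    intro n
    rcases Nat.eq_zero_or_pos n with rfl | hn
    · rw [List.count_eq_zero_of_not_mem fun h0 => (lam.pos_of_mem_rowLens 0 h0).false,
        List.count_eq_zero_of_not_mem fun h0 => (mu.pos_of_mem_rowLens 0 h0).false]
    · lift n to ℕ+ using hn
      rw [← multiplicities_apply lam.pos_of_mem_rowLens, ← multiplicities_apply mu.pos_of_mem_rowLens]
      exact DFunLike.congr_fun h n
  exact hperm.eq_of_pairwise (fun a b _ _ h1 h2 => le_antisymm h2 h1) lam.rowLens_sorted.pairwise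
    mu.rowLens_sorted.pairwise

theorem modeVectorSpan_le_span_image (ε : ℚ) (N : ℕ) : modeVectorSpan ε N ≤
    Submodule.span ℤ ((fun lam : YoungDiagram => modeVector (vertexMode ε) lam.rowLens) ''
      {lam | lam.card ≤ N}) := by
  refine Submodule.span_mono ?_
  rintro _ ⟨w, ⟨hw, hpos, hsum⟩, rfl⟩
  have h := YoungDiagram.rowLens_ofRowLens_eq_self (hw := hw.sortedGE) hpos
  refine ⟨YoungDiagram.ofRowLens w hw.sortedGE, ?_, ?_⟩
  · rw [Set.mem_ofPred_eq, ← YoungDiagram.sum_rowLens, h]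
    exact hsum
  · simp only [h]

theorem mul_self_of_eq {ε : ℚ} (hε : ε = 1 ∨ ε = -1) : ε * ε = 1 := by
  rcases hε with rfl | rfl <;> norm_num

theorem linearCombination_mem_weightFiltration {ε : ℚ} {v : YoungDiagram → Fock} {N : ℕ}
    (hv : ∀ lam, v lam ∈ weightFiltration ε lam.card) {c : YoungDiagram →₀ ℤ}
    (hc : c ∈ Finsupp.supported ℤ ℤ {lam : YoungDiagram | lam.card ≤ N}) :
    Finsupp.linearCombination ℤ v c ∈ weightFiltration ε N := by
  rw [Finsupp.linearCombination_apply]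
  refine Submodule.sum_mem _ fun lam hlam => Submodule.smul_mem _ _ ?_
  have h : lam.card ≤ N := (Finsupp.mem_supported ℤ c).1 hc hlam
  exact weightFiltration_mono (by exact_mod_cast h) (hv lam)

instance finite_weightFiltration (ε : ℚ) (N : ℕ) : Module.Finite ℤ (weightFiltration ε N) := by
  refine Module.Finite.span_of_finite ℤ (Set.Finite.image _ ?_)
  simpa using finite_partWeight_le N

/-- A rank count replaces an explicit unitriangular matrix. For partitions of size at most N, the
free module on them embeds into the filtration step through the monomials in the g_n and surjects
onto it through the vectors. -/
theorem linearIndependent_modeVector {ε : ℚ} (hε : ε = 1 ∨ ε = -1) :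
    LinearIndependent ℤ fun lam : YoungDiagram => modeVector (vertexMode ε) lam.rowLens := by
  have hε2 := mul_self_of_eq hε
  let u : YoungDiagram → Fock := fun lam => modeVector (vertexMode ε) lam.rowLens
  let g : YoungDiagram → Fock := fun lam => genMonomial ε (multiplicities lam.rowLens)
  have hu : ∀ lam, u lam ∈ weightFiltration ε lam.card := fun lam => by
    rw [← YoungDiagram.sum_rowLens]
    exact modeVector_mem_weightFiltration hε2 _
  have hg : ∀ lam, g lam ∈ weightFiltration ε lam.card := fun lam => by
    rw [← YoungDiagram.sum_rowLens, ← partWeight_multiplicities lam.pos_of_mem_rowLens]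
    exact genMonomial_mem le_rfl
  have hgi : LinearIndependent ℤ g :=
    (linearIndependent_genMonomial hε).comp _ multiplicities_rowLens_injective
  have key : ∀ N : ℕ, ∀ c ∈ Finsupp.supported ℤ ℤ {lam : YoungDiagram | lam.card ≤ N},
      Finsupp.linearCombination ℤ u c = 0 → c = 0 := by
    intro N c hc hc0
    let fu := (Finsupp.linearCombination ℤ u).restrict
      (p := Finsupp.supported ℤ ℤ {lam : YoungDiagram | lam.card ≤ N})
      (q := weightFiltration ε N) fun c hc => linearCombination_mem_weightFiltration hu hc
    let fg := (Finsupp.linearCombination ℤ g).restrict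
      (p := Finsupp.supported ℤ ℤ {lam : YoungDiagram | lam.card ≤ N})
      (q := weightFiltration ε N) fun c hc => linearCombination_mem_weightFiltration hg hc
    have hfg : Function.Injective fg := fun a b hab => Subtype.ext (hgi (congrArg Subtype.val hab))
    have hfu : Function.Surjective fu := by
      rintro ⟨y, hy⟩
      obtain ⟨b, hb, rfl⟩ := (Finsupp.mem_span_image_iff_linearCombination ℤ).1
        (modeVectorSpan_le_span_image ε N (weightFiltration_le_modeVectorSpan hε2 N hy))
      exact ⟨⟨b, hb⟩, rfl⟩
    -- Over ℤ, a surjection onto a finitely generated module from a module that embeds in it is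
    -- injective.
    have hinj := OrzechProperty.injective_of_surjective_of_injective fg fu hfg hfu
    have h0 : (⟨c, hc⟩ : Finsupp.supported ℤ ℤ {lam : YoungDiagram | lam.card ≤ N}) = 0 :=
      hinj (Subtype.ext (hc0.trans (congrArg Subtype.val (map_zero fu)).symm))
    exact congrArg Subtype.val h0
  rw [linearIndependent_iff]
  intro c hc
  refine key (c.support.sup YoungDiagram.card) c ((Finsupp.mem_supported ℤ c).2 fun lam hlam => ?_) hc
  exact Finset.le_sup (f := YoungDiagram.card) hlam

theorem isIntegralBasis_modeVector {ε : ℚ} (hε : ε = 1 ∨ ε = -1) :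
    IsIntegralBasis fun lam : YoungDiagram => modeVector (vertexMode ε) lam.rowLens := by
  have hε2 := mul_self_of_eq hε
  have hspan : Submodule.span ℤ
      (Set.range fun lam : YoungDiagram => modeVector (vertexMode ε) lam.rowLens) =
      Submodule.span ℤ (Set.range (genMonomial ε)) := by
    refine le_antisymm (Submodule.span_le.2 ?_) (Submodule.span_le.2 ?_)
    · rintro _ ⟨lam, rfl⟩
      exact Submodule.span_mono (Set.image_subset_range _ _)
        (modeVector_mem_weightFiltration hε2 lam.rowLens)
    · rintro _ ⟨m, rfl⟩
      exact Submodule.span_mono (Set.image_subset_range _ _)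
        (modeVectorSpan_le_span_image ε _
          (weightFiltration_le_modeVectorSpan hε2 (partWeight m) (genMonomial_mem le_rfl)))
  have hmap := congrArg (Submodule.map realizeInt) hspan
  rw [Submodule.map_span, Submodule.map_span, ← Set.range_comp, ← Set.range_comp] at hmap
  have hmap' := hmap.trans (span_realize_genMonomial hε)
  refine ⟨?_, hmap'⟩
  refine (linearIndependent_modeVector hε).map_injOn realizeInt ?_
  rw [hspan]
  intro x hx y hy hxy
  -- Independence of the realized monomials makes the realization injective on their ℤ-span, so
  -- independence of the vectors survives it.
  have hker : ∀ z ∈ Submodule.span ℤ (Set.range (genMonomial ε)), realizeInt z = 0 → z = 0 := by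
    intro z hz hz0
    obtain ⟨c, rfl⟩ := (Finsupp.mem_span_range_iff_exists_finsupp).1 hz
    have hli := linearIndependent_iff.1 (linearIndependent_realize_genMonomial hε) c ?_
    · rw [hli, Finsupp.sum_zero_index]
    · rw [← hz0, map_finsuppSum, Finsupp.linearCombination_apply]
      simp only [map_smul, realizeInt_apply]
  refine sub_eq_zero.1 (hker _ (Submodule.sub_mem _ hx hy) ?_)
  rw [map_sub, hxy, sub_self]

theorem IsIntegralBasis.reindex {ι κ : Type} {v : ι → Fock} (hv : IsIntegralBasis v) (e : κ ≃ ι) :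
    IsIntegralBasis (v ∘ e) := by
  refine ⟨(linearIndependent_equiv e).2 hv.1, ?_⟩
  rw [← hv.2]
  congr 1
  exact e.surjective.range_comp fun i => realize (v i)

theorem IsIntegralBasis.of_sign_mul {ι : Type} {v w : ι → Fock} (hv : IsIntegralBasis v)
    (k : ι → ℕ) (h : ∀ i, v i = (-1 : Fock) ^ k i * w i) : IsIntegralBasis w := by
  have hw : (fun i => realize (w i)) =
      fun i => ((-1 : ℤˣ) ^ k i) • realize (v i) := by
    funext i
    rw [h, map_mul, map_pow, map_neg, map_one, Units.smul_def, zsmul_eq_mul, Units.val_pow_eq_pow_val,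
      Units.val_neg, Units.val_one, Int.cast_pow, Int.cast_neg, Int.cast_one, ← mul_assoc, ← mul_pow,
      neg_one_mul, neg_neg, one_pow, one_mul]
  refine ⟨?_, ?_⟩
  · rw [hw]
    exact hv.1.units_smul fun i => (-1 : ℤˣ) ^ k i
  · rw [← hv.2, hw]
    refine le_antisymm (Submodule.span_le.2 ?_) (Submodule.span_le.2 ?_)
    · rintro _ ⟨i, rfl⟩
      exact Submodule.smul_mem _ _ (Submodule.subset_span ⟨i, rfl⟩)
    · rintro _ ⟨i, rfl⟩
      refine (Submodule.smul_mem_iff_of_isUnit _ ((-1 : ℤˣ) ^ k i).isUnit).1 ?_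
      exact Submodule.subset_span ⟨i, rfl⟩

theorem isIntegralBasis_vectorY : IsIntegralBasis fun lam : YoungDiagram => vectorY lam := by
  simp only [vectorY_eq]
  exact isIntegralBasis_modeVector (Or.inl rfl)

theorem isIntegralBasis_vectorWStar_transpose :
    IsIntegralBasis fun lam : YoungDiagram => vectorWStar lam.transpose := by
  simp only [vectorWStar_eq]
  exact (isIntegralBasis_modeVector (Or.inr rfl)).reindex YoungDiagram.transposeOrderIso.toEquiv

theorem theoremT :
    (∀ lam : YoungDiagram,
      vectorY lam = (-1 : Fock) ^ lam.card * vectorYStar lam.transpose ∧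
      vectorW lam = (-1 : Fock) ^ lam.card * vectorWStar lam.transpose) ∧
    IsIntegralBasis (fun lam : YoungDiagram => vectorY lam) ∧
    IsIntegralBasis (fun lam : YoungDiagram => vectorYStar lam.transpose) ∧
    IsIntegralBasis (fun lam : YoungDiagram => vectorW lam) ∧
    IsIntegralBasis (fun lam : YoungDiagram => vectorWStar lam.transpose) := by
  refine ⟨fun lam => ⟨vectorY_eq_vectorYStar_transpose lam, vectorW_eq_vectorWStar_transpose lam⟩,
    isIntegralBasis_vectorY,
    isIntegralBasis_vectorY.of_sign_mul YoungDiagram.card vectorY_eq_vectorYStar_transpose,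
    isIntegralBasis_vectorWStar_transpose.of_sign_mul YoungDiagram.card fun lam => ?_,
    isIntegralBasis_vectorWStar_transpose⟩
  rw [vectorW_eq_vectorWStar_transpose, ← mul_assoc, ← mul_pow, neg_one_mul, neg_neg, one_pow,
    one_mul]

end
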